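/- Let $\mathcal Z$ be an outcome space with reference measure $dz$ (counting measure if $\mathcal Z$ is finite or countable, Lebesgue measure if $\mathcal Z\subseteq\mathbb R^k$; more generally any measurable space with a $\sigma$-finite measure), let $X:\mathcal Z\to\mathbb R$ and $h:\mathcal Z\to[0,\infty)$ be measurable, and let $\mathcal M$ be the single-parameter exponential family with densities $M_\eta(z)=e^{-\eta X(z)}h(z)/\mathrm Z(\eta)$, $\mathrm Z(\eta)=\int e^{-\eta X(z)}h(z)\,dz$, $\eta\in\Theta_{\rm nat}=\{\eta:\mathrm Z(\eta)<\infty\}$. Assume that $\mathcal M$ is regular ($\Theta_{\rm nat}$ is an open interval) and that $X$ is not almost everywhere constant with respect to $h(z)\,dz$. Let $\Theta_{\rm mean}=\{E_{M_\eta}[X]:\eta\in\Theta_{\rm nat}\}$, write $M_\mu$ for the element of $\mathcal M$ with mean value $\mu\in\Theta_{\rm mean}$, and let $I_{\mathcal M}(\mu)=E_{M_\mu}\big[(\frac{d}{d\mu}\ln M_\mu(Z))^2\big]$ be the Fisher information and $D(\cdot\|\cdot)$ the Kullback–Leibler divergence. Let $Z_1,Z_2,\dots$ be i.i.d. with law $P$,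 an arbitrary probability distribution on $\mathcal Z$ (not necessarily with a density), such that $\mu^*:=E_P[X]$ exists and lies in $\Theta_{\rm mean}$, $X\in\overline{\Theta_{\rm mean}}$ holds $P$-almost surely, and $M_{\mu^*}(Z)>0$ holds $P$-almost surely with $E_P|\ln M_{\mu^*}(Z)|<\infty$. Suppose that the following holds both for $T=X$ and for $T=-X$, where asymptotic statements refer to $\mu$ as the mean value of $T$ tending to the upper end of its range: * If $T$ is unbounded from above (its set of mean values $\pm\Theta_{\rm mean}$ is unbounded from above), then there is $k\in\{4,6,8,\dots\}$ such that the first $k$ moments of $T$ exist under $P$, $\frac{d^2}{d\mu^2}I_{\mathcal M}(\mu)=O(\mu^{k-4})$, $\frac{d^4}{d\mu^4}D(M_{\mu^*}\|M_\mu)=O(\mu^{k-6})$, and either $I_{\mathcal M}$ is constant or $I_{\mathcal M}(\mu)=O(\mu^{k/2-3})$, as $\mu\to\infty$. * If $T$ is bounded from above, with $g$ the supremum of its mean values, then $\frac{d^2}{d\mu^2}I_{\mathcal M}(\mu)$, $\frac{d^4}{d\mu^4}D(M_{\mu^*}\|M_\mu)$ and $I_{\mathcal M}(\mu)$ are each $O((g-\mu)^{-r})$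 for some $r\in\mathbb N$, as $\mu\uparrow g$. Fix $x_0\in\Theta_{\rm mean}$ and $n_0>0$ and put $\hat\mu_n=\dfrac{x_0n_0+\sum_{i=1}^nX(z_i)}{n+n_0}$. Let $U$ be the slightly squashed ML prequential model $$U(z_{n+1}\mid z^n)=M_{\hat\mu_n}(z_{n+1})\,\frac{1+\frac1{2n}I_{\mathcal M}(\hat\mu_n)\,(X(z_{n+1})-\hat\mu_n)^2}{1+\frac1{2n}}\quad(n\ge1),\qquad U(z_1)=M_{\hat\mu_0}(z_1)=M_{x_0}(z_1),$$ with codelength $L_U(z^n)=\sum_{i=0}^{n-1}-\ln U(z_{i+1}\mid z^i)$. Then for every $n$ the codelength $L_U(Z^n)$ and all $-\ln M_\mu(Z^n)$, $\mu\in\Theta_{\rm mean}$, have finite expectation, the infimum below is finite, and the relative redundancy satisfies $$\mathcal R_U(n):=E_P[L_U(Z^n)]-\inf_{\mu\in\Theta_{\rm mean}}E_P[-\ln M_\mu(Z^n)]=\tfrac12\ln n+O(1)\qquad(n\to\infty).$$ -/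

import Mathlib

open MeasureTheory Filter Topology Asymptotics

noncomputable section

/-- The data of a single-parameter exponential family on the outcome space `𝒵`: a reference
measure `ν` (counting measure for countable `𝒵`, Lebesgue measure for `𝒵 ⊆ ℝ^k`), a sufficient
statistic `X` and a carrier `h`. -/
structure ExpFamily (𝒵 : Type*) [MeasurableSpace 𝒵] where
  ν : Measure 𝒵
  sigmaFinite : SigmaFinite ν
  X : 𝒵 → ℝ
  measurable_X : Measurable X
  h : 𝒵 → ℝ
  measurable_h : Measurable h
  h_nonneg : ∀ z, 0 ≤ h z

namespace ExpFamily

variable {𝒵 : Type*} [MeasurableSpace 𝒵] (M : ExpFamily 𝒵)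

/-- The partition function `Z(η) = ∫ exp (-η X(z)) h(z) dν(z)`. -/
def partition (η : ℝ) : ℝ := ∫ z, Real.exp (-η * M.X z) * M.h z ∂M.ν

/-- The natural parameter space: all `η` with `Z(η) < ∞`. -/
def natSpace : Set ℝ := {η | Integrable (fun z => Real.exp (-η * M.X z) * M.h z) M.ν}

/-- The density `M_η(z) = exp (-η X(z)) h(z) / Z(η)` in the natural parameterization. -/
def natDensity (η : ℝ) (z : 𝒵) : ℝ := (M.partition η)⁻¹ * (Real.exp (-η * M.X z) * M.h z)

/-- The mean of `X` under `M_η`. -/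
def meanOf (η : ℝ) : ℝ := ∫ z, M.X z * M.natDensity η z ∂M.ν

/-- The mean-value parameter space. -/
def meanSpace : Set ℝ := M.meanOf '' M.natSpace

/-- A regular family: the natural parameter space is an open interval, and the family is a genuine
one-parameter family, that is, `X` is not almost surely constant with respect to the carrier
(this also excludes the zero carrier). -/
structure Regular : Prop where
  isOpen_natSpace : IsOpen M.natSpace
  ordConnected_natSpace : M.natSpace.OrdConnected
  nondegenerate : ¬ ∃ c : ℝ, ∀ᵐ z ∂M.ν, 0 < M.h z → M.X z = c

/-- The natural parameter that belongs to the mean value `m` (meaningful for `m ∈ meanSpace`). -/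
def natOf (m : ℝ) : ℝ := Function.invFunOn M.meanOf M.natSpace m

/-- The density `M_m` in the mean-value parameterization. -/
def density (m : ℝ) (z : 𝒵) : ℝ := M.natDensity (M.natOf m) z

/-- The distribution `M_m` on `𝒵` with mean-value parameter `m`. -/
def dist (m : ℝ) : Measure 𝒵 := M.ν.withDensity (fun z => ENNReal.ofReal (M.density m z))

/-- The Fisher information at `m` in the mean-value parameterization, the second moment of the
score `d/dm ln M_m(Z)` under `M_m`. -/
def fisherInfo (m : ℝ) : ℝ :=
  ∫ z, (deriv (fun m' => Real.log (M.density m' z)) m) ^ 2 * M.density m z ∂M.ν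

/-- The Kullback-Leibler divergence `D(M_{m₀} ‖ M_m)` as a real number. -/
def divergence (m₀ m : ℝ) : ℝ := (InformationTheory.klDiv (M.dist m₀) (M.dist m)).toReal

/-- The smoothed maximum likelihood estimator
`μ̂(z^n) = (x₀ n₀ + X(z_1) + ⋯ + X(z_n)) / (n + n₀)`. -/
def mle (x₀ n₀ : ℝ) (n : ℕ) (z : Fin n → 𝒵) : ℝ :=
  (x₀ * n₀ + ∑ j, M.X (z j)) / (n + n₀)

/-- The slightly squashed version of the density `M_m` at sample size `n`. The squashing factor
is formed with `1 / (2 n)`; for `n = 0` there is no squashing. -/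
def squashed (n : ℕ) (m : ℝ) (z : 𝒵) : ℝ :=
  if n = 0 then M.density m z
  else M.density m z *
    ((1 + 1 / (2 * (n : ℝ)) * M.fisherInfo m * (M.X z - m) ^ 2) / (1 + 1 / (2 * (n : ℝ))))

/-- The slightly squashed ML prequential model: `U(z_{n+1} | z^n)` is the squashed version of
`M_{μ̂(z^n)}`, evaluated at `z_{n+1}`. -/
def squashedML (x₀ n₀ : ℝ) (n : ℕ) (past : Fin n → 𝒵) (z : 𝒵) : ℝ :=
  M.squashed n (M.mle x₀ n₀ n past) z

/-- The codelength in nats `L_U(z^n) = ∑_{i < n} - ln U(z_{i+1} | z^i)` of the first `n` outcomes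
of a sequence, for a prequential model `U` given by its conditional densities
(`ω i` is the outcome `z_{i+1}`). -/
def codeLength (U : (n : ℕ) → (Fin n → 𝒵) → 𝒵 → ℝ) (n : ℕ) (ω : ℕ → 𝒵) : ℝ :=
  ∑ i ∈ Finset.range n, -Real.log (U i (fun j : Fin i => ω j) (ω i))

/-- The codelength `- ln M_m(z^n)` of the first `n` outcomes under the i.i.d. extension
of `M_m`. -/
def modelCodeLength (m : ℝ) (n : ℕ) (ω : ℕ → 𝒵) : ℝ :=
  -Real.log (∏ i ∈ Finset.range n, M.density m (ω i))

/-- The relative redundancy `E_P[L_U(Z^n)] - inf_m E_P[- ln M_m(Z^n)]`, where `m` ranges over the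
mean-value parameter space and `Z_1, Z_2, …` are i.i.d. with law `P`. -/
def relRedundancy (P : Measure 𝒵) [IsProbabilityMeasure P]
    (U : (n : ℕ) → (Fin n → 𝒵) → 𝒵 → ℝ) (n : ℕ) : ℝ :=
  (∫ ω, codeLength U n ω ∂(Measure.infinitePi (fun _ : ℕ => P))) -
    ⨅ m : M.meanSpace, ∫ ω, M.modelCodeLength m n ω ∂(Measure.infinitePi (fun _ : ℕ => P))

/-- The moment and growth condition for the statistic `T = ε X`, where `ε = 1` or `ε = -1`.
The variable `t` is the mean value of `T`, so that `ε * t` is the corresponding mean value of `X`;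
all derivatives are of even order, so that it does not matter whether they are taken with respect
to the mean of `X` or of `T`. The mean-value space is the interior of the convex hull of the set of
possible values of `X`, so `T` is bounded above exactly if the set of its mean values is, and the
suprema agree. "Polynomial in `1 / (g - t)`" is meant as a bound near the end point:
`O((g - t)^(-r))` for some `r`, as `t` increases to `g`. -/
structure TailCondition (P : Measure 𝒵) (mstar ε : ℝ) : Prop where
  unbounded : ¬ BddAbove {t : ℝ | ε * t ∈ M.meanSpace} →
    ∃ k : ℕ, 4 ≤ k ∧ Even k ∧
      (∀ j ≤ k, Integrable (fun z => (ε * M.X z) ^ j) P) ∧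
      ((fun t : ℝ => iteratedDeriv 2 M.fisherInfo (ε * t))
        =O[atTop] fun t : ℝ => t ^ ((k : ℤ) - 4)) ∧
      ((fun t : ℝ => iteratedDeriv 4 (M.divergence mstar) (ε * t))
        =O[atTop] fun t : ℝ => t ^ ((k : ℤ) - 6)) ∧
      ((∃ c : ℝ, ∀ m ∈ M.meanSpace, M.fisherInfo m = c) ∨
        (fun t : ℝ => M.fisherInfo (ε * t))
          =O[atTop] fun t : ℝ => t ^ (((k / 2 : ℕ) : ℤ) - 3))
  bounded : ∀ g : ℝ, IsLUB {t : ℝ | ε * t ∈ M.meanSpace} g →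
    (∃ r : ℕ, (fun t : ℝ => iteratedDeriv 2 M.fisherInfo (ε * t))
      =O[𝓝[<] g] fun t : ℝ => (1 / (g - t)) ^ r) ∧
    (∃ r : ℕ, (fun t : ℝ => iteratedDeriv 4 (M.divergence mstar) (ε * t))
      =O[𝓝[<] g] fun t : ℝ => (1 / (g - t)) ^ r) ∧
    (∃ r : ℕ, (fun t : ℝ => M.fisherInfo (ε * t))
      =O[𝓝[<] g] fun t : ℝ => (1 / (g - t)) ^ r)

/-- The moment and growth condition, required both for `T = X` and for `T = -X`. -/
def GrowthCondition (P : Measure 𝒵) (mstar : ℝ) : Prop :=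
  M.TailCondition P mstar 1 ∧ M.TailCondition P mstar (-1)

end ExpFamily

end

/-! Write d for the difference of the estimator at sample size n and μ*, Y = X(Z_{n+1}) - μ*, V =
E_P[Y²], and I for the Fisher information. In an exponential family, log-losses compare exactly: -ln
M_μ(z) = -ln M_{μ*}(z) + (η(μ) - η(μ*))(X(z) - μ*) + D(μ*‖μ), with D in the closed form `bregman`
(`log_density_eq_bregman`). The linear term has mean zero under every P with E_P[X] = μ*. Hence the
infimum is n E_P[-ln M_{μ*}], attained at μ*. Since the estimator is independent of the next
outcome, the linear term also drops out of the prequential loss, and the redundancy is the sum over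
n of E D(μ*‖μ* + d) - E ln(1 + I(μ* + d)(Y - d)²/(2n)) + ln(1 + 1/(2n)).

To leading order D is I(μ*) d²/2, and E d² = V/n + O(1/n²), so the first expectation is I(μ*)V/(2n)
+ O(n^(-3/2)). Linearizing the logarithm gives I(μ*)V/(2n) + O(1/n²) for the second
(`exists_abs_integral_logSquash_sub_le`). These cancel for every V: squashing corrects the mismatch
between the variance of P and that of the model. What remains is ln(1 + 1/(2n)) = 1/(2n) + O(1/n²),
and the sum is (1/2) ln n + O(1).

The work lies in the remainders. As η' = -I and dD/dμ = I(μ)(μ - μ*), a bound W for I'' between μ*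
and the estimator controls them all, and E[W d²] = O(1/n), E[W d⁴] = O(1/n²) suffice (`IsEnvelope`).
Towards an unbounded end W is a polynomial in d, and moments of P give the rates
(`exists_isEnvelope_of_polynomial`). Towards a bounded end the smoothing by x₀, n₀ keeps the
estimator at distance of order 1/n from the end point, so W grows polynomially in n at worst, on an
event that a Chernoff bound makes superpolynomially rare (`exists_isEnvelope_of_bounded`). -/

noncomputable section

/-! ### Natural and mean-value parameters; the Fisher information. -/

namespace ExpFamily

variable {𝒵 : Type*} [MeasurableSpace 𝒵] (M : ExpFamily 𝒵)

/-- The carrier measure `h dν`. -/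
def carrier : Measure 𝒵 := M.ν.withDensity (fun z => ENNReal.ofReal (M.h z))

lemma integrable_carrier_iff (g : 𝒵 → ℝ) :
    Integrable g M.carrier ↔ Integrable (fun z => g z * M.h z) M.ν := by
  have := integrable_withDensity_iff (μ := M.ν) (f := fun z => ENNReal.ofReal (M.h z))
    M.measurable_h.ennreal_ofReal (ae_of_all _ fun _ => ENNReal.ofReal_lt_top) (g := g)
  rw [carrier, this]
  simp only [ENNReal.toReal_ofReal (M.h_nonneg _)]

lemma integral_carrier (g : 𝒵 → ℝ) :
    ∫ z, g z ∂M.carrier = ∫ z, g z * M.h z ∂M.ν := by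
  rw [carrier, integral_withDensity_eq_integral_toReal_smul
    M.measurable_h.ennreal_ofReal (ae_of_all _ fun _ => ENNReal.ofReal_lt_top)]
  simp only [ENNReal.toReal_ofReal (M.h_nonneg _), smul_eq_mul, mul_comm]

lemma ae_carrier_iff (p : 𝒵 → Prop) :
    (∀ᵐ z ∂M.carrier, p z) ↔ ∀ᵐ z ∂M.ν, 0 < M.h z → p z := by
  rw [carrier, ae_withDensity_iff M.measurable_h.ennreal_ofReal]
  simp [ENNReal.ofReal_eq_zero]

/-- The statistic enters as -X because the density carries exp(-η X). Under this sign the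
log-partition function is a cumulant generating function and inherits its analyticity and derivative
formulas. -/
lemma natSpace_eq :
    M.natSpace = ProbabilityTheory.integrableExpSet (fun z => -M.X z) M.carrier := by
  ext η
  simp only [natSpace, ProbabilityTheory.integrableExpSet, Set.mem_ofPred_eq]
  rw [integrable_carrier_iff]
  simp

/-- The log-partition function `ln Z(η)`. -/
def logPartition : ℝ → ℝ := ProbabilityTheory.cgf (fun z => -M.X z) M.carrier

lemma partition_eq_mgf (η : ℝ) :
    M.partition η = ProbabilityTheory.mgf (fun z => -M.X z) M.carrier η := by
  simp only [partition, ProbabilityTheory.mgf]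
  rw [integral_carrier]
  simp

lemma logPartition_eq (η : ℝ) : M.logPartition η = Real.log (M.partition η) := by
  rw [logPartition, ProbabilityTheory.cgf, partition_eq_mgf]


variable {M}

lemma carrier_ne_zero (hM : M.Regular) : M.carrier ≠ 0 := fun h =>
  hM.nondegenerate ⟨0, (M.ae_carrier_iff fun z => M.X z = 0).1 (by simp [h])⟩

lemma mem_interior (hM : M.Regular) {η : ℝ} (hη : η ∈ M.natSpace) :
    η ∈ interior (ProbabilityTheory.integrableExpSet (fun z => -M.X z) M.carrier) := by
  rw [← natSpace_eq, hM.isOpen_natSpace.interior_eq]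
  exact hη

lemma partition_pos (hM : M.Regular) {η : ℝ} (hη : η ∈ M.natSpace) : 0 < M.partition η := by
  rw [partition_eq_mgf]
  refine ProbabilityTheory.mgf_pos' (carrier_ne_zero hM) ?_
  rw [natSpace_eq] at hη
  exact hη

lemma analyticAt_logPartition (hM : M.Regular) {η : ℝ} (hη : η ∈ M.natSpace) :
    AnalyticAt ℝ M.logPartition η :=
  ProbabilityTheory.analyticAt_cgf (mem_interior hM hη)

lemma deriv_logPartition (hM : M.Regular) {η : ℝ} (hη : η ∈ M.natSpace) :
    deriv M.logPartition η = -M.meanOf η := by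
  rw [logPartition, ProbabilityTheory.deriv_cgf (mem_interior hM hη), integral_carrier,
    ← partition_eq_mgf, meanOf, ← integral_neg, ← integral_div]
  congr 1 with z
  rw [natDensity]
  simp only [mul_neg, neg_mul, div_eq_inv_mul]
  ring

lemma hasDerivAt_logPartition (hM : M.Regular) {η : ℝ} (hη : η ∈ M.natSpace) :
    HasDerivAt M.logPartition (-M.meanOf η) η := by
  rw [← deriv_logPartition hM hη]
  exact (analyticAt_logPartition hM hη).differentiableAt.hasDerivAt

/-- The variance of the sufficient statistic under `M_η`. -/
def varOf (M : ExpFamily 𝒵) (η : ℝ) : ℝ := iteratedDeriv 2 M.logPartition η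

lemma integrable_natDensity_sq (hM : M.Regular) {η : ℝ} (hη : η ∈ M.natSpace) (c : ℝ) :
    Integrable (fun z => (M.X z - c) ^ 2 * Real.exp (η * -M.X z)) M.carrier := by
  have key (n : ℕ) : Integrable (fun z => (-M.X z) ^ n * Real.exp (η * -M.X z)) M.carrier :=
    ProbabilityTheory.integrable_pow_mul_exp_of_mem_interior_integrableExpSet
      (mem_interior hM hη) n
  refine (((key 2).add ((key 1).const_mul (2 * c))).add ((key 0).const_mul (c ^ 2))).congr
    (ae_of_all _ fun z => ?_)
  simp only [Pi.add_apply]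
  ring

lemma varOf_eq_integral (hM : M.Regular) {η : ℝ} (hη : η ∈ M.natSpace) :
    M.varOf η = ∫ z, (M.X z - M.meanOf η) ^ 2 * M.natDensity η z ∂M.ν := by
  rw [varOf, logPartition, ProbabilityTheory.iteratedDeriv_two_cgf_eq_integral
    (mem_interior hM hη), integral_carrier, ← partition_eq_mgf, ← integral_div]
  congr 1 with z
  have := deriv_logPartition hM hη
  rw [logPartition] at this
  rw [natDensity, this]
  simp only [mul_neg, neg_mul, div_eq_inv_mul]
  ring

lemma varOf_pos (hM : M.Regular) {η : ℝ} (hη : η ∈ M.natSpace) : 0 < M.varOf η := by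
  rw [varOf, logPartition, ProbabilityTheory.iteratedDeriv_two_cgf_eq_integral
    (mem_interior hM hη), ← partition_eq_mgf]
  refine div_pos ?_ (partition_pos hM hη)
  have hd := deriv_logPartition hM hη
  rw [logPartition] at hd
  rw [hd]
  have hint := integrable_natDensity_sq hM hη (M.meanOf η)
  have heq : (fun z => (-M.X z - -M.meanOf η) ^ 2 * Real.exp (η * -M.X z))
      = fun z => (M.X z - M.meanOf η) ^ 2 * Real.exp (η * -M.X z) := by
    ext z; ring
  rw [heq]
  refine lt_of_le_of_ne (integral_nonneg fun z => by positivity) fun h0 => ?_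
  have := (integral_eq_zero_iff_of_nonneg (fun z => by positivity) hint).1 h0.symm
  refine hM.nondegenerate ⟨M.meanOf η, (M.ae_carrier_iff fun z => M.X z = M.meanOf η).1 ?_⟩
  filter_upwards [this] with z hz
  simpa [sub_eq_zero] using hz

lemma contDiffOn_varOf (hM : M.Regular) : ContDiffOn ℝ ⊤ M.varOf M.natSpace := by
  have h : AnalyticOnNhd ℝ M.logPartition M.natSpace := fun η hη => analyticAt_logPartition hM hη
  have := h.iterated_deriv 2
  rw [← iteratedDeriv_eq_iterate] at this
  exact this.contDiffOn (hM.isOpen_natSpace.uniqueDiffOn)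

lemma hasDerivAt_meanOf (hM : M.Regular) {η : ℝ} (hη : η ∈ M.natSpace) :
    HasDerivAt M.meanOf (-M.varOf η) η := by
  have h1 : HasDerivAt (deriv M.logPartition) (M.varOf η) η := by
    rw [varOf, iteratedDeriv_succ, iteratedDeriv_one]
    exact (analyticAt_logPartition hM hη).deriv.differentiableAt.hasDerivAt
  refine h1.neg.congr_of_eventuallyEq ?_
  filter_upwards [hM.isOpen_natSpace.mem_nhds hη] with y hy
  simp [deriv_logPartition hM hy]

lemma strictAntiOn_meanOf (hM : M.Regular) : StrictAntiOn M.meanOf M.natSpace := by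
  refine strictAntiOn_of_deriv_neg hM.ordConnected_natSpace.convex
    (fun η hη => (hasDerivAt_meanOf hM hη).continuousAt.continuousWithinAt) fun η hη => ?_
  have hη' := interior_subset hη
  rw [(hasDerivAt_meanOf hM hη').deriv]
  exact neg_neg_of_pos (varOf_pos hM hη')

lemma natOf_mem {m : ℝ} (hm : m ∈ M.meanSpace) : M.natOf m ∈ M.natSpace :=
  Function.invFunOn_mem hm

lemma meanOf_natOf {m : ℝ} (hm : m ∈ M.meanSpace) : M.meanOf (M.natOf m) = m :=
  Function.invFunOn_eq hm

lemma hasStrictDerivAt_meanOf (hM : M.Regular) {η : ℝ} (hη : η ∈ M.natSpace) :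
    HasStrictDerivAt M.meanOf (-M.varOf η) η := by
  have h := (analyticAt_logPartition hM hη).deriv.neg
  have h' : AnalyticAt ℝ M.meanOf η := by
    refine h.congr ?_
    filter_upwards [hM.isOpen_natSpace.mem_nhds hη] with y hy
    simp [deriv_logPartition hM hy]
  rw [← (hasDerivAt_meanOf hM hη).deriv]
  exact h'.hasStrictDerivAt

lemma isOpen_meanSpace (hM : M.Regular) : IsOpen M.meanSpace := by
  rw [isOpen_iff_mem_nhds]
  rintro _ ⟨η, hη, rfl⟩
  rw [← (hasStrictDerivAt_meanOf hM hη).map_nhds_eq (neg_ne_zero.2 (varOf_pos hM hη).ne')]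
  exact image_mem_map (hM.isOpen_natSpace.mem_nhds hη)

lemma ordConnected_meanSpace (hM : M.Regular) : M.meanSpace.OrdConnected := by
  have : IsPreconnected M.meanSpace := hM.ordConnected_natSpace.isPreconnected.image _
    fun η hη => (hasDerivAt_meanOf hM hη).continuousAt.continuousWithinAt
  exact this.ordConnected

/-- The mean map has non-zero strict derivative, so it sends neighbourhoods to neighbourhoods; its
injectivity identifies the chosen preimages with `natOf`. -/
lemma continuousAt_natOf (hM : M.Regular) {m : ℝ} (hm : m ∈ M.meanSpace) :
    ContinuousAt M.natOf m := by
  intro U hU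
  have hη := natOf_mem hm
  have h := (hasStrictDerivAt_meanOf hM hη).map_nhds_eq (neg_ne_zero.2 (varOf_pos hM hη).ne')
  rw [meanOf_natOf hm] at h
  have h2 : M.meanOf '' (U ∩ M.natSpace) ∈ 𝓝 m := by
    rw [← h]
    exact image_mem_map (inter_mem hU (hM.isOpen_natSpace.mem_nhds hη))
  rw [mem_map]
  refine mem_of_superset h2 ?_
  rintro _ ⟨η, ⟨hηU, hηN⟩, rfl⟩
  have hmem : M.meanOf η ∈ M.meanSpace := ⟨η, hηN, rfl⟩
  have : M.natOf (M.meanOf η) = η :=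
    (strictAntiOn_meanOf hM).injOn (natOf_mem hmem) hηN (meanOf_natOf hmem)
  simpa [this] using hηU

lemma hasDerivAt_natOf_varOf (hM : M.Regular) {m : ℝ} (hm : m ∈ M.meanSpace) :
    HasDerivAt M.natOf (-(M.varOf (M.natOf m))⁻¹) m := by
  rw [← inv_neg]
  refine HasDerivAt.of_local_left_inverse (continuousAt_natOf hM hm)
    (hasDerivAt_meanOf hM (natOf_mem hm)) (neg_ne_zero.2 (varOf_pos hM (natOf_mem hm)).ne') ?_
  filter_upwards [(isOpen_meanSpace hM).mem_nhds hm] with y hy using meanOf_natOf hy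

lemma density_eq (m : ℝ) (z : 𝒵) : M.density m z =
    (M.partition (M.natOf m))⁻¹ * (Real.exp (-M.natOf m * M.X z) * M.h z) := rfl

lemma density_pos (hM : M.Regular) {m : ℝ} (hm : m ∈ M.meanSpace) {z : 𝒵} (hz : 0 < M.h z) :
    0 < M.density m z := by
  have := partition_pos hM (natOf_mem hm)
  rw [density_eq]
  positivity

lemma log_density (hM : M.Regular) {m : ℝ} (hm : m ∈ M.meanSpace) {z : 𝒵} (hz : 0 < M.h z) :
    Real.log (M.density m z) =
      -M.logPartition (M.natOf m) - M.natOf m * M.X z + Real.log (M.h z) := by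
  have := partition_pos hM (natOf_mem hm)
  rw [density_eq, Real.log_mul (by positivity) (by positivity),
    Real.log_mul (by positivity) hz.ne', Real.log_exp, Real.log_inv, logPartition_eq]
  ring

/-- The inverse function rule gives η'(m) = -1/Var, so the score is (X - m)/Var and its second
moment is Var/Var². -/
lemma fisherInfo_eq (hM : M.Regular) {m : ℝ} (hm : m ∈ M.meanSpace) :
    M.fisherInfo m = (M.varOf (M.natOf m))⁻¹ := by
  have hη := natOf_mem hm
  have hv := varOf_pos hM hη
  have hderiv {z : 𝒵} (hz : 0 < M.h z) : deriv (fun m' => Real.log (M.density m' z)) m =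
      (M.varOf (M.natOf m))⁻¹ * (M.X z - m) := by
    have h1 := (hasDerivAt_logPartition hM hη).comp m (hasDerivAt_natOf_varOf hM hm)
    have h2 := (h1.neg.sub ((hasDerivAt_natOf_varOf hM hm).mul_const (M.X z))).add_const
      (Real.log (M.h z))
    have h3 := h2.congr_of_eventuallyEq (f₁ := fun m' => Real.log (M.density m' z)) (by
      filter_upwards [(isOpen_meanSpace hM).mem_nhds hm] with y hy
      rw [log_density hM hy hz]
      simp)
    rw [h3.deriv, meanOf_natOf hm]
    ring
  have : (fun z => (deriv (fun m' => Real.log (M.density m' z)) m) ^ 2 * M.density m z)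
      = fun z => ((M.varOf (M.natOf m))⁻¹) ^ 2 *
        ((M.X z - M.meanOf (M.natOf m)) ^ 2 * M.natDensity (M.natOf m) z) := by
    ext z
    rcases (M.h_nonneg z).eq_or_lt with h0 | h0
    · simp [density, natDensity, ← h0]
    · rw [hderiv h0, meanOf_natOf hm, density]
      ring
  rw [fisherInfo, this, integral_const_mul, ← varOf_eq_integral hM hη]
  field_simp

lemma fisherInfo_pos (hM : M.Regular) {m : ℝ} (hm : m ∈ M.meanSpace) : 0 < M.fisherInfo m := by
  rw [fisherInfo_eq hM hm]
  exact inv_pos.2 (varOf_pos hM (natOf_mem hm))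

lemma hasDerivAt_natOf (hM : M.Regular) {m : ℝ} (hm : m ∈ M.meanSpace) :
    HasDerivAt M.natOf (-M.fisherInfo m) m := by
  rw [fisherInfo_eq hM hm]
  exact hasDerivAt_natOf_varOf hM hm

/-- Bootstrapping: the derivative of `natOf` is a smooth function of `natOf` itself, so each degree
of smoothness yields the next. -/
lemma contDiffOn_natOf (hM : M.Regular) (n : ℕ) : ContDiffOn ℝ n M.natOf M.meanSpace := by
  induction n with
  | zero =>
    rw [Nat.cast_zero, contDiffOn_zero]
    exact fun m hm => (continuousAt_natOf hM hm).continuousWithinAt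
  | succ n ih =>
    rw [Nat.cast_succ, contDiffOn_succ_iff_deriv_of_isOpen (isOpen_meanSpace hM)]
    refine ⟨fun m hm => (hasDerivAt_natOf hM hm).differentiableAt.differentiableWithinAt,
      fun h => by simp at h, ?_⟩
    have h1 : ContDiffOn ℝ n (fun m => -(M.varOf (M.natOf m))⁻¹) M.meanSpace :=
      ((((contDiffOn_varOf hM).of_le le_top).comp ih fun _ hm => natOf_mem hm).inv
        fun m hm => (varOf_pos hM (natOf_mem hm)).ne').neg
    exact h1.congr fun m hm => (hasDerivAt_natOf_varOf hM hm).deriv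

lemma contDiffOn_fisherInfo (hM : M.Regular) (n : ℕ) :
    ContDiffOn ℝ n M.fisherInfo M.meanSpace :=
  ((((contDiffOn_varOf hM).of_le le_top).comp (contDiffOn_natOf hM n) fun _ hm => natOf_mem hm).inv
    fun _ hm => (varOf_pos hM (natOf_mem hm)).ne').congr fun _ hm => fisherInfo_eq hM hm

/-! ### The divergence as excess expected log-loss. -/

/-- The closed form `(η(m) - η(m₀)) m₀ + ln Z(η(m)) - ln Z(η(m₀))` of the divergence
`D(M_{m₀} ‖ M_m)`. -/
def bregman (M : ExpFamily 𝒵) (m₀ m : ℝ) : ℝ :=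
  (M.natOf m - M.natOf m₀) * m₀ + M.logPartition (M.natOf m) - M.logPartition (M.natOf m₀)

/-- An identity for each outcome, with no reference to its law. Under any law with mean `m₀` the
linear term averages out, which is why P need not belong to the model. -/
lemma log_density_eq_bregman (hM : M.Regular) {m₀ m : ℝ} (hm₀ : m₀ ∈ M.meanSpace)
    (hm : m ∈ M.meanSpace) {z : 𝒵} (hz : 0 < M.h z) :
    -Real.log (M.density m z) = -Real.log (M.density m₀ z)
      + (M.natOf m - M.natOf m₀) * (M.X z - m₀) + M.bregman m₀ m := by
  rw [log_density hM hm hz, log_density hM hm₀ hz, bregman]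
  ring

lemma hasDerivAt_bregman (hM : M.Regular) (m₀ : ℝ) {m : ℝ} (hm : m ∈ M.meanSpace) :
    HasDerivAt (M.bregman m₀) (M.fisherInfo m * (m - m₀)) m := by
  have h1 := (hasDerivAt_logPartition hM (natOf_mem hm)).comp m (hasDerivAt_natOf hM hm)
  have h2 := ((((hasDerivAt_natOf hM hm).sub_const (M.natOf m₀)).mul_const m₀).add h1).sub_const
    (M.logPartition (M.natOf m₀))
  refine h2.congr_deriv ?_
  rw [meanOf_natOf hm]
  ring

lemma bregman_self (m₀ : ℝ) : M.bregman m₀ m₀ = 0 := by simp [bregman]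

/-- The derivative I(m)(m - m₀) has the sign of m - m₀, so by the mean value theorem the function
does not fall below its value 0 at `m₀`. -/
lemma bregman_nonneg (hM : M.Regular) {m₀ m : ℝ} (hm₀ : m₀ ∈ M.meanSpace)
    (hm : m ∈ M.meanSpace) : 0 ≤ M.bregman m₀ m := by
  have hd (x) (hx : x ∈ M.meanSpace) := hasDerivAt_bregman hM m₀ hx
  rcases lt_trichotomy m₀ m with h | rfl | h
  · have hsub := (ordConnected_meanSpace hM).out hm₀ hm
    obtain ⟨c, hc, he⟩ := exists_hasDerivAt_eq_slope (M.bregman m₀) _ h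
      (fun x hx => (hd x (hsub hx)).continuousAt.continuousWithinAt)
      (fun x hx => hd x (hsub (Set.Ioo_subset_Icc_self hx)))
    have := fisherInfo_pos hM (hsub (Set.Ioo_subset_Icc_self hc))
    rw [bregman_self, sub_zero, eq_div_iff (sub_pos.2 h).ne'] at he
    rw [← he]
    have := hc.1
    exact mul_nonneg (mul_nonneg (by positivity) (by linarith)) (by linarith)
  · rw [bregman_self]
  · have hsub := (ordConnected_meanSpace hM).out hm hm₀
    obtain ⟨c, hc, he⟩ := exists_hasDerivAt_eq_slope (M.bregman m₀) _ h
      (fun x hx => (hd x (hsub hx)).continuousAt.continuousWithinAt)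
      (fun x hx => hd x (hsub (Set.Ioo_subset_Icc_self hx)))
    have := fisherInfo_pos hM (hsub (Set.Ioo_subset_Icc_self hc))
    rw [bregman_self, zero_sub, eq_div_iff (sub_pos.2 h).ne'] at he
    have h3 := hc.2
    have : 0 ≤ M.fisherInfo c * (m₀ - c) * (m₀ - m) :=
      mul_nonneg (mul_nonneg (by positivity) (by linarith)) (by linarith)
    nlinarith

end ExpFamily

/-! ### Taylor bounds from a bound on the second derivative of the Fisher information. -/

lemma abs_sub_le_of_hasDerivAt {f f' : ℝ → ℝ} {a b C : ℝ}
    (hf : ∀ x ∈ Set.uIcc a b, HasDerivAt f (f' x) x)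
    (hb : ∀ x ∈ Set.uIcc a b, |f' x| ≤ C) : |f b - f a| ≤ C * |b - a| :=
  (convex_uIcc a b).norm_image_sub_le_of_norm_hasDerivWithin_le
    (fun x hx => (hf x hx).hasDerivWithinAt) hb Set.left_mem_uIcc Set.right_mem_uIcc

lemma abs_sub_le_of_mem_uIcc {a b x : ℝ} (hx : x ∈ Set.uIcc a b) : |x - a| ≤ |b - a| :=
  Set.abs_sub_left_of_mem_uIcc hx

namespace ExpFamily

variable {𝒵 : Type*} [MeasurableSpace 𝒵] {M : ExpFamily 𝒵}

lemma hasDerivAt_fisherInfo (hM : M.Regular) {m : ℝ} (hm : m ∈ M.meanSpace) :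
    HasDerivAt M.fisherInfo (deriv M.fisherInfo m) m :=
  (((contDiffOn_fisherInfo hM 1).differentiableOn (by norm_num)).differentiableAt
    ((isOpen_meanSpace hM).mem_nhds hm)).hasDerivAt

lemma contDiffOn_deriv_fisherInfo (hM : M.Regular) :
    ContDiffOn ℝ 1 (deriv M.fisherInfo) M.meanSpace :=
  ((contDiffOn_succ_iff_deriv_of_isOpen (n := 1) (isOpen_meanSpace hM)).1
    (by exact_mod_cast contDiffOn_fisherInfo hM 2)).2.2

lemma hasDerivAt_deriv_fisherInfo (hM : M.Regular) {m : ℝ} (hm : m ∈ M.meanSpace) :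
    HasDerivAt (deriv M.fisherInfo) (iteratedDeriv 2 M.fisherInfo m) m := by
  rw [iteratedDeriv_succ, iteratedDeriv_one]
  exact (((contDiffOn_deriv_fisherInfo hM).differentiableOn (by norm_num)).differentiableAt
    ((isOpen_meanSpace hM).mem_nhds hm)).hasDerivAt

lemma continuousOn_iteratedDeriv_two_fisherInfo (hM : M.Regular) :
    ContinuousOn (iteratedDeriv 2 M.fisherInfo) M.meanSpace := by
  have := ((contDiffOn_succ_iff_deriv_of_isOpen (n := 0) (isOpen_meanSpace hM)).1
    (by simpa using contDiffOn_deriv_fisherInfo hM)).2.2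
  rw [iteratedDeriv_succ, iteratedDeriv_one]
  exact this.continuousOn

lemma uIcc_subset_meanSpace (hM : M.Regular) {a b : ℝ} (ha : a ∈ M.meanSpace)
    (hb : b ∈ M.meanSpace) : Set.uIcc a b ⊆ M.meanSpace :=
  (ordConnected_meanSpace hM).uIcc_subset ha hb

/-- Second order Taylor bound for the Fisher information. -/
lemma abs_fisherInfo_taylor_le (hM : M.Regular) {m₀ m B : ℝ} (hm₀ : m₀ ∈ M.meanSpace)
    (hm : m ∈ M.meanSpace)
    (hB : ∀ s ∈ Set.uIcc m₀ m, |iteratedDeriv 2 M.fisherInfo s| ≤ B) :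
    |M.fisherInfo m - M.fisherInfo m₀ - deriv M.fisherInfo m₀ * (m - m₀)| ≤ B * (m - m₀) ^ 2 := by
  have hsub := uIcc_subset_meanSpace hM hm₀ hm
  have hB0 : 0 ≤ B := (abs_nonneg _).trans (hB m₀ Set.left_mem_uIcc)
  have h1 (s) (hs : s ∈ Set.uIcc m₀ m) :
      |deriv M.fisherInfo s - deriv M.fisherInfo m₀| ≤ B * |m - m₀| := by
    have hs' : Set.uIcc m₀ s ⊆ Set.uIcc m₀ m := Set.uIcc_subset_uIcc_left hs
    refine (abs_sub_le_of_hasDerivAt (fun x hx => hasDerivAt_deriv_fisherInfo hM (hsub (hs' hx)))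
      fun x hx => hB x (hs' hx)).trans ?_
    exact mul_le_mul_of_nonneg_left (abs_sub_le_of_mem_uIcc hs) hB0
  -- A second use of the mean value inequality in place of integration; it loses the factor 1/2, and
  -- only the order matters below.
  have h2 := abs_sub_le_of_hasDerivAt (a := m₀) (b := m) (C := B * |m - m₀|)
    (f := fun x => M.fisherInfo x - deriv M.fisherInfo m₀ * (x - m₀))
    (f' := fun x => deriv M.fisherInfo x - deriv M.fisherInfo m₀)
    (fun x hx => ((hasDerivAt_fisherInfo hM (hsub hx)).sub
        (((hasDerivAt_id x).sub_const m₀).const_mul (deriv M.fisherInfo m₀))).congr_deriv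
          (by simp)) h1
  rw [mul_assoc, ← sq, sq_abs] at h2
  convert h2 using 2
  ring

/-- Third order Taylor bound for the natural parameter as a function of the mean. -/
lemma abs_natOf_taylor_le (hM : M.Regular) {m₀ m B : ℝ} (hm₀ : m₀ ∈ M.meanSpace)
    (hm : m ∈ M.meanSpace)
    (hB : ∀ s ∈ Set.uIcc m₀ m, |iteratedDeriv 2 M.fisherInfo s| ≤ B) :
    |M.natOf m - M.natOf m₀ + M.fisherInfo m₀ * (m - m₀)
      + deriv M.fisherInfo m₀ / 2 * (m - m₀) ^ 2| ≤ B * |m - m₀| ^ 3 := by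
  have hsub := uIcc_subset_meanSpace hM hm₀ hm
  have hB0 : 0 ≤ B := (abs_nonneg _).trans (hB m₀ Set.left_mem_uIcc)
  have h2 := abs_sub_le_of_hasDerivAt (a := m₀) (b := m) (C := B * |m - m₀| ^ 2)
    (f := fun x => M.natOf x + M.fisherInfo m₀ * (x - m₀)
      + deriv M.fisherInfo m₀ / 2 * (x - m₀) ^ 2)
    (f' := fun x => -(M.fisherInfo x - M.fisherInfo m₀ - deriv M.fisherInfo m₀ * (x - m₀)))
    (fun x hx => by
      have h := ((hasDerivAt_natOf hM (hsub hx)).add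
        (((hasDerivAt_id x).sub_const m₀).const_mul (M.fisherInfo m₀))).add
        ((((hasDerivAt_id x).sub_const m₀).pow 2).const_mul (deriv M.fisherInfo m₀ / 2))
      refine h.congr_deriv ?_
      simp
      ring) (fun x hx => by
      rw [abs_neg]
      refine (abs_fisherInfo_taylor_le hM hm₀ (hsub hx) fun s hs =>
        hB s (Set.uIcc_subset_uIcc_left hx hs)).trans ?_
      rw [← sq_abs (x - m₀)]
      exact mul_le_mul_of_nonneg_left
        (pow_le_pow_left₀ (abs_nonneg _) (abs_sub_le_of_mem_uIcc hx) 2) hB0)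
  calc _ = _ := by congr 1; simp; ring
    _ ≤ _ := h2
    _ = _ := by ring

/-- Fourth order Taylor bound for the divergence. -/
lemma abs_bregman_taylor_le (hM : M.Regular) {m₀ m B : ℝ} (hm₀ : m₀ ∈ M.meanSpace)
    (hm : m ∈ M.meanSpace)
    (hB : ∀ s ∈ Set.uIcc m₀ m, |iteratedDeriv 2 M.fisherInfo s| ≤ B) :
    |M.bregman m₀ m - M.fisherInfo m₀ / 2 * (m - m₀) ^ 2
      - deriv M.fisherInfo m₀ / 3 * (m - m₀) ^ 3| ≤ B * (m - m₀) ^ 4 := by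
  have hsub := uIcc_subset_meanSpace hM hm₀ hm
  have hB0 : 0 ≤ B := (abs_nonneg _).trans (hB m₀ Set.left_mem_uIcc)
  have h2 := abs_sub_le_of_hasDerivAt (a := m₀) (b := m) (C := B * |m - m₀| ^ 2 * |m - m₀|)
    (f := fun x => M.bregman m₀ x - M.fisherInfo m₀ / 2 * (x - m₀) ^ 2
      - deriv M.fisherInfo m₀ / 3 * (x - m₀) ^ 3)
    (f' := fun x => (M.fisherInfo x - M.fisherInfo m₀ - deriv M.fisherInfo m₀ * (x - m₀))
      * (x - m₀))
    (fun x hx => by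
      have h := ((hasDerivAt_bregman hM m₀ (hsub hx)).sub
        ((((hasDerivAt_id x).sub_const m₀).pow 2).const_mul (M.fisherInfo m₀ / 2))).sub
        ((((hasDerivAt_id x).sub_const m₀).pow 3).const_mul (deriv M.fisherInfo m₀ / 3))
      refine h.congr_deriv ?_
      simp
      ring) (fun x hx => by
      rw [abs_mul]
      have hx' := abs_sub_le_of_mem_uIcc hx
      refine mul_le_mul ((abs_fisherInfo_taylor_le hM hm₀ (hsub hx) fun s hs =>
        hB s (Set.uIcc_subset_uIcc_left hx hs)).trans ?_) hx' (abs_nonneg _) (by positivity)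
      rw [← sq_abs (x - m₀)]
      gcongr)
  have h4 : |m - m₀| ^ 4 = (m - m₀) ^ 4 := (by decide : Even 4).pow_abs _
  calc _ = _ := by congr 1; simp [bregman_self]
    _ ≤ _ := h2
    _ = _ := by rw [← h4]; ring

/-! ### From asymptotic growth conditions to bounds on a whole side of μ*. -/

/-- The growth of the second derivative of the Fisher information towards one end (`ε = 1` the
upper, `ε = -1` the lower) of the mean-value space: polynomial if the space is unbounded there,
polynomial in the inverse distance to the end point if it is bounded. -/
def TailBound (M : ExpFamily 𝒵) (P : Measure 𝒵) (m₀ x₀ ε : ℝ) : Prop :=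
  (∃ k : ℕ, 4 ≤ k ∧ Even k ∧ Integrable (fun z => M.X z ^ k) P ∧ ∃ C : ℝ, 0 ≤ C ∧
    ∀ m ∈ M.meanSpace, 0 ≤ ε * (m - m₀) →
      |iteratedDeriv 2 M.fisherInfo m| ≤ C * (1 + |m - m₀| ^ (k - 4))) ∨
  (∃ (g a C : ℝ) (r : ℕ), ε * m₀ < a ∧ a < g ∧ ε * x₀ < g ∧ 0 ≤ C ∧ (∀ m ∈ M.meanSpace, ε * m < g) ∧
    (∀ᵐ z ∂P, ε * M.X z ≤ g) ∧
    (∀ m ∈ M.meanSpace, 0 ≤ ε * (m - m₀) → ε * m ≤ a → |iteratedDeriv 2 M.fisherInfo m| ≤ C) ∧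
    (∀ m ∈ M.meanSpace, a < ε * m →
      |iteratedDeriv 2 M.fisherInfo m| ≤ C * (1 / (g - ε * m)) ^ r))

/-- The hypotheses speak only of a neighbourhood of the end; on the compact stretch from `m₀` to
that neighbourhood, continuity bounds I''. -/
lemma tailBound_of_tailCondition (hM : M.Regular) {P : Measure 𝒵} {m₀ x₀ ε : ℝ}
    (hε : ε = 1 ∨ ε = -1) (hm₀ : m₀ ∈ M.meanSpace) (hx₀ : x₀ ∈ M.meanSpace)
    (hsupp : ∀ᵐ z ∂P, M.X z ∈ closure M.meanSpace) (h : M.TailCondition P m₀ ε) :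
    M.TailBound P m₀ x₀ ε := by
  have hεε : ε * ε = 1 := by rcases hε with rfl | rfl <;> norm_num
  have hinv (x : ℝ) : ε * (ε * x) = x := by rw [← mul_assoc, hεε, one_mul]
  have hcompact (t : ℝ) (ht : ε * t ∈ M.meanSpace) : ∃ C : ℝ, 0 ≤ C ∧
      ∀ m, 0 ≤ ε * (m - m₀) → ε * m ≤ t → |iteratedDeriv 2 M.fisherInfo m| ≤ C := by
    have hsub := uIcc_subset_meanSpace hM hm₀ ht
    obtain ⟨C, hC⟩ := isCompact_uIcc.exists_bound_of_continuousOn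
      ((continuousOn_iteratedDeriv_two_fisherInfo hM).mono hsub)
    refine ⟨C, (norm_nonneg _).trans (hC m₀ Set.left_mem_uIcc), fun m h1 h2 => hC m ?_⟩
    rw [Set.mem_uIcc]
    rcases hε with rfl | rfl
    · left; constructor <;> linarith
    · right; constructor <;> linarith
  by_cases hb : BddAbove {t : ℝ | ε * t ∈ M.meanSpace}
  · right
    have hne : {t : ℝ | ε * t ∈ M.meanSpace}.Nonempty := ⟨ε * m₀, by simpa [hinv] using hm₀⟩
    have hlub := isLUB_csSup hne hb
    set g := sSup {t : ℝ | ε * t ∈ M.meanSpace} with hg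
    have hlt (m) (hm : m ∈ M.meanSpace) : ε * m < g := by
      have hopen : IsOpen {t : ℝ | ε * t ∈ M.meanSpace} :=
        (isOpen_meanSpace hM).preimage (continuous_const_mul ε)
      have hmem : {t : ℝ | ε * t ∈ M.meanSpace} ∈ 𝓝[>] (ε * m) :=
        mem_nhdsWithin_of_mem_nhds (hopen.mem_nhds (by simpa [hinv] using hm))
      obtain ⟨t, ht, ht'⟩ := (Filter.Eventually.and hmem self_mem_nhdsWithin).exists
      exact lt_of_lt_of_le ht' (hlub.1 ht)
    obtain ⟨⟨r, hr⟩, -, -⟩ := h.bounded g hlub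
    obtain ⟨C₀, hC₀, hO⟩ := hr.exists_pos
    obtain ⟨a₀, ha₀, hO⟩ := (mem_nhdsLT_iff_exists_Ioo_subset).1 (isBigOWith_iff.1 hO)
    -- The threshold `a` is a mean value of T beyond both `a₀`, where the asymptotic bound takes
    -- effect, and the mean `ε * m₀`.
    obtain ⟨a, haJ, ha⟩ := (lt_isLUB_iff hlub).1 (max_lt ha₀ (hlt m₀ hm₀))
    obtain ⟨C, hC, hCb⟩ := hcompact a haJ
    refine ⟨g, a, max C C₀, r, (le_max_right _ _).trans_lt ha, ?_, hlt x₀ hx₀,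
      hC.trans (le_max_left _ _), hlt, ?_, fun m _ h1 h2 => (hCb m h1 h2).trans (le_max_left _ _),
      fun m hm h1 => ?_⟩
    · simpa [hinv] using hlt _ haJ
    · have hcl : closure M.meanSpace ⊆ {x | ε * x ≤ g} :=
        closure_minimal (fun m hm => (hlt m hm).le)
          (isClosed_le (continuous_const_mul ε) continuous_const)
      filter_upwards [hsupp] with z hz using hcl hz
    · have := hO ⟨((le_max_left _ _).trans_lt ha).trans h1, hlt m hm⟩
      simp only [Set.mem_ofPred_eq, hinv, Real.norm_eq_abs] at this
      have hpos : 0 < g - ε * m := sub_pos.2 (hlt m hm)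
      refine this.trans ?_
      rw [abs_of_nonneg (by positivity : (0:ℝ) ≤ (1 / (g - ε * m)) ^ r)]
      gcongr
      exact le_max_right _ _
  · left
    obtain ⟨k, hk, hke, hmom, hO, -, -⟩ := h.unbounded hb
    refine ⟨k, hk, hke, ?_, ?_⟩
    · refine (hmom k le_rfl).congr (ae_of_all _ fun z => ?_)
      rcases hε with rfl | rfl
      · simp
      · simp [hke.neg_pow]
    obtain ⟨C₀, hC₀, hO⟩ := hO.exists_pos
    obtain ⟨t₀, ht₀⟩ := eventually_atTop.1 (isBigOWith_iff.1 hO)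
    obtain ⟨t, htJ, ht⟩ := not_bddAbove_iff.1 hb (max t₀ 0)
    obtain ⟨C, hC, hCb⟩ := hcompact t htJ
    -- `C` serves up to `t`, the second summand beyond, where |m| ≤ |m₀| + |m - m₀|. For k = 4
    -- truncated subtraction turns the power of 2 into 1.
    refine ⟨C + C₀ * (2 ^ (k - 4 - 1) * (1 + |m₀| ^ (k - 4))), by positivity, fun m _ h1 => ?_⟩
    have hd : 0 ≤ |m - m₀| ^ (k - 4) := by positivity
    have hm' : 0 ≤ |m₀| ^ (k - 4) := by positivity
    rcases le_or_gt (ε * m) t with h2 | h2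
    · refine (hCb m h1 h2).trans ?_
      have : 0 ≤ C₀ * (2 ^ (k - 4 - 1) * (1 + |m₀| ^ (k - 4))) := by positivity
      nlinarith [mul_nonneg hC hd, mul_nonneg this hd]
    · have := ht₀ (ε * m) (((le_max_left _ _).trans ht.le).trans h2.le)
      rw [hinv, show ((k : ℤ) - 4) = ((k - 4 : ℕ) : ℤ) by omega, zpow_natCast] at this
      simp only [Real.norm_eq_abs, abs_pow] at this
      have habs : |ε * m| ≤ |m₀| + |m - m₀| := by
        have h3 : |ε * m| = |m| := by rcases hε with rfl | rfl <;> simp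
        rw [h3]
        calc |m| = |m₀ + (m - m₀)| := by ring_nf
          _ ≤ _ := abs_add_le _ _
      have h4 : |ε * m| ^ (k - 4) ≤
          2 ^ (k - 4 - 1) * (|m₀| ^ (k - 4) + |m - m₀| ^ (k - 4)) :=
        (pow_le_pow_left₀ (abs_nonneg _) habs _).trans
          (add_pow_le (abs_nonneg _) (abs_nonneg _) _)
      have h5 : (2:ℝ) ^ (k - 4 - 1) * (|m₀| ^ (k - 4) + |m - m₀| ^ (k - 4)) ≤
          2 ^ (k - 4 - 1) * ((1 + |m₀| ^ (k - 4)) * (1 + |m - m₀| ^ (k - 4))) := by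
        gcongr
        nlinarith
      calc _ ≤ C₀ * |ε * m| ^ (k - 4) := this
        _ ≤ C₀ * (2 ^ (k - 4 - 1) * ((1 + |m₀| ^ (k - 4)) * (1 + |m - m₀| ^ (k - 4)))) := by
          gcongr
          exact h4.trans h5
        _ ≤ _ := by nlinarith [mul_nonneg hC hd]

end ExpFamily

/-! ### Moments and large deviations of sums of i.i.d. variables. -/

/-- Meant for s a partial sum and x the next summand: the first-order term vanishes in expectation,
so only the remainder contributes to the growth of moments. -/
lemma exists_abs_add_pow_sub_le (p : ℕ) : ∃ C : ℝ, 0 ≤ C ∧ ∀ s x : ℝ,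
    |(s + x) ^ (p + 2) - s ^ (p + 2) - (p + 2) * s ^ (p + 1) * x|
      ≤ C * (|s| ^ p * x ^ 2 + |x| ^ (p + 2)) := by
  induction p with
  | zero =>
    refine ⟨1, zero_le_one, fun s x => ?_⟩
    have : (s + x) ^ (0 + 2) - s ^ (0 + 2) - ((0 : ℕ) + 2) * s ^ (0 + 1) * x = x ^ 2 := by
      push_cast; ring
    rw [this, abs_of_nonneg (sq_nonneg x)]
    simp [sq_nonneg]
  | succ p ih =>
    obtain ⟨C, hC, h⟩ := ih
    refine ⟨4 * C + (p + 2), by positivity, fun s x => ?_⟩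
    have key : (s + x) ^ (p + 1 + 2) - s ^ (p + 1 + 2) - ((p + 1 : ℕ) + 2) * s ^ (p + 1 + 1) * x
        = (s + x) * ((s + x) ^ (p + 2) - s ^ (p + 2) - (p + 2) * s ^ (p + 1) * x)
          + (p + 2) * (s ^ (p + 1) * x ^ 2) := by
      push_cast; ring
    rw [key]
    have hs := abs_nonneg s
    have hx := abs_nonneg x
    have hx2 : x ^ 2 = |x| ^ 2 := (sq_abs x).symm
    -- Of the four monomials in the product, each is at most one of the two on the right, according
    -- to which of |s| and |x| is larger.
    have hmix : (|s| + |x|) * (|s| ^ p * |x| ^ 2 + |x| ^ (p + 2))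
        ≤ 4 * (|s| ^ (p + 1) * |x| ^ 2 + |x| ^ (p + 3)) := by
      generalize |s| = a at *
      generalize |x| = b at *
      have e1 : 0 ≤ a ^ (p + 1) * b ^ 2 := by positivity
      have e2 : 0 ≤ b ^ (p + 3) := by positivity
      rcases le_total a b with hab | hab
      · have h1 : a * b ^ (p + 2) ≤ b ^ (p + 3) := by
          rw [pow_succ' b (p + 2)]; gcongr
        have h2 : a ^ p * b ^ 3 ≤ b ^ (p + 3) := by
          rw [pow_add]; gcongr
        have h3 : (a + b) * (a ^ p * b ^ 2 + b ^ (p + 2)) = a ^ (p + 1) * b ^ 2 + a * b ^ (p + 2)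
            + a ^ p * b ^ 3 + b ^ (p + 3) := by ring
        linarith
      · have h1 : a * b ^ (p + 2) ≤ a ^ (p + 1) * b ^ 2 := by
          rw [pow_add, pow_succ' a p, mul_assoc]; gcongr
        have h2 : a ^ p * b ^ 3 ≤ a ^ (p + 1) * b ^ 2 := by
          rw [pow_succ a p, mul_assoc, pow_succ' b 2]; gcongr
        have h3 : (a + b) * (a ^ p * b ^ 2 + b ^ (p + 2)) = a ^ (p + 1) * b ^ 2 + a * b ^ (p + 2)
            + a ^ p * b ^ 3 + b ^ (p + 3) := by ring
        linarith
    calc _ ≤ |s + x| * |(s + x) ^ (p + 2) - s ^ (p + 2) - (p + 2) * s ^ (p + 1) * x|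
          + (p + 2) * (|s| ^ (p + 1) * |x| ^ 2) := by
          refine (abs_add_le _ _).trans ?_
          simp only [abs_mul, abs_pow, abs_of_nonneg (by positivity : (0 : ℝ) ≤ (p : ℝ) + 2)]
          exact le_rfl
      _ ≤ (|s| + |x|) * (C * (|s| ^ p * x ^ 2 + |x| ^ (p + 2)))
          + (p + 2) * (|s| ^ (p + 1) * |x| ^ 2) := by
          gcongr
          · exact abs_add_le _ _
          · exact h s x
      _ ≤ _ := by
          rw [hx2]
          have h3 := mul_le_mul_of_nonneg_left hmix hC
          have h4 : 0 ≤ ((p : ℝ) + 2) * |x| ^ (p + 3) := by positivity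
          rw [show p + 1 + 2 = p + 3 by ring]
          nlinarith

namespace ProbabilityTheory

variable {Ω : Type*} {Y : ℕ → Ω → ℝ}

/-- The partial sums of a sequence of random variables. -/
def partialSum (Y : ℕ → Ω → ℝ) (n : ℕ) (ω : Ω) : ℝ := ∑ i ∈ Finset.range n, Y i ω

lemma partialSum_zero (ω : Ω) : partialSum Y 0 ω = 0 := by simp [partialSum]

lemma partialSum_succ (n : ℕ) (ω : Ω) : partialSum Y (n + 1) ω = partialSum Y n ω + Y n ω := by
  simp [partialSum, Finset.sum_range_succ]

variable [MeasurableSpace Ω]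

/-- A sequence of independent, identically distributed real random variables. -/
structure IsIID (Y : ℕ → Ω → ℝ) (μ : Measure Ω) : Prop where
  measurable : ∀ i, Measurable (Y i)
  indep : iIndepFun Y μ
  ident : ∀ i, IdentDistrib (Y i) (Y 0) μ μ

variable {μ : Measure Ω}

namespace IsIID

lemma measurable_partialSum (h : IsIID Y μ) (n : ℕ) : Measurable (partialSum Y n) :=
  Finset.measurable_sum _ fun i _ => h.measurable i

lemma indepFun_partialSum (h : IsIID Y μ) (n : ℕ) : IndepFun (partialSum Y n) (Y n) μ := by
  have := h.indep.indepFun_sum_range_succ h.measurable n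
  convert this using 1
  ext ω
  simp [partialSum]

lemma memLp (h : IsIID Y μ) {p : ENNReal} (hp : MemLp (Y 0) p μ) (i : ℕ) : MemLp (Y i) p μ :=
  (h.ident i).memLp_iff.2 hp

lemma memLp_partialSum (h : IsIID Y μ) {p : ENNReal} (hp : MemLp (Y 0) p μ) (n : ℕ) :
    MemLp (partialSum Y n) p μ :=
  memLp_finsetSum _ fun i _ => h.memLp hp i

lemma integral_pow_mul_pow (h : IsIID Y μ) (i j : ℕ) (n : ℕ) :
    ∫ ω, partialSum Y n ω ^ i * Y n ω ^ j ∂μ =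
      (∫ ω, partialSum Y n ω ^ i ∂μ) * ∫ ω, Y 0 ω ^ j ∂μ := by
  have hind : IndepFun (fun ω => partialSum Y n ω ^ i) (fun ω => Y n ω ^ j) μ :=
    (h.indepFun_partialSum n).comp (measurable_id.pow_const i) (measurable_id.pow_const j)
  have h2 := hind.integral_fun_mul_eq_mul_integral
    ((h.measurable_partialSum n).pow_const i).aestronglyMeasurable
    ((h.measurable n).pow_const j).aestronglyMeasurable
  rw [h2]
  congr 1
  exact ((h.ident n).comp (measurable_id.pow_const j)).integral_eq

end IsIID

variable [IsProbabilityMeasure μ]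

lemma integrable_pow_of_memLp {f : Ω → ℝ} {k j : ℕ} (hf : MemLp f k μ) (hj : j ≤ k) :
    Integrable (fun ω => f ω ^ j) μ := by
  have h1 := (hf.mono_exponent (p := (j : ENNReal)) (by exact_mod_cast hj)).integrable_norm_pow'
  refine h1.mono' (hf.aestronglyMeasurable.pow j) (ae_of_all _ fun ω => ?_)
  simp

namespace IsIID

lemma integrable_pow_mul_pow (h : IsIID Y μ) {k i j : ℕ} (hp : MemLp (Y 0) k μ) (hi : i ≤ k)
    (hj : j ≤ k) (n : ℕ) : Integrable (fun ω => partialSum Y n ω ^ i * Y n ω ^ j) μ := by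
  have hind : IndepFun (fun ω => partialSum Y n ω ^ i) (fun ω => Y n ω ^ j) μ :=
    (h.indepFun_partialSum n).comp (measurable_id.pow_const i) (measurable_id.pow_const j)
  exact hind.integrable_mul (integrable_pow_of_memLp (h.memLp_partialSum hp n) hi)
    (integrable_pow_of_memLp (h.memLp hp n) hj)

/-- Even moments of partial sums of centered i.i.d. variables grow as in the Gaussian case. -/
lemma exists_integral_partialSum_pow_le (h : IsIID Y μ) (h0 : ∫ ω, Y 0 ω ∂μ = 0) (j : ℕ)
    (hp : MemLp (Y 0) (2 * j : ℕ) μ) :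
    ∃ C : ℝ, 0 ≤ C ∧ ∀ n : ℕ, ∫ ω, partialSum Y n ω ^ (2 * j) ∂μ ≤ C * (n : ℝ) ^ j := by
  induction j with
  | zero => exact ⟨1, zero_le_one, fun n => by simp⟩
  | succ j ih =>
    obtain ⟨C, hC, hS⟩ := ih (hp.mono_exponent (by
      exact_mod_cast Nat.mul_le_mul_left 2 (Nat.le_succ j)))
    obtain ⟨D, hD, hpow⟩ := exists_abs_add_pow_sub_le (2 * j)
    set v := ∫ ω, Y 0 ω ^ 2 ∂μ with hv
    set κ := ∫ ω, Y 0 ω ^ (2 * (j + 1)) ∂μ with hκ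
    have hv0 : 0 ≤ v := integral_nonneg fun ω => sq_nonneg _
    have hκ0 : 0 ≤ κ := integral_nonneg fun ω => (even_two_mul _).pow_nonneg _
    -- The increment of the moment of order 2(j+1) at step n is at most D(C n^j v + κ), hence at
    -- most A (n+1)^j, and such increments sum to at most A n^(j+1).
    set A := D * (C * v + κ) with hA
    have hA0 : 0 ≤ A := by positivity
    refine ⟨A, hA0, fun n => ?_⟩
    induction n with
    | zero => simp [partialSum_zero]
    | succ n ihn =>
      have i1 := integrable_pow_of_memLp (h.memLp_partialSum hp n) le_rfl
      have i2 : Integrable (fun ω => partialSum Y n ω ^ (2 * j + 1) * Y n ω ^ 1) μ :=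
        h.integrable_pow_mul_pow hp (by omega) (by omega) n
      have i3 : Integrable (fun ω => partialSum Y n ω ^ (2 * j) * Y n ω ^ 2) μ :=
        h.integrable_pow_mul_pow hp (by omega) (by omega) n
      have i4 := integrable_pow_of_memLp (h.memLp hp n) le_rfl
      have step : ∫ ω, partialSum Y (n + 1) ω ^ (2 * (j + 1)) ∂μ ≤
          ∫ ω, (partialSum Y n ω ^ (2 * (j + 1))
            + ((2 * j : ℕ) + 2) * (partialSum Y n ω ^ (2 * j + 1) * Y n ω ^ 1)
            + (D * (partialSum Y n ω ^ (2 * j) * Y n ω ^ 2)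
            + D * Y n ω ^ (2 * (j + 1)))) ∂μ := by
        refine integral_mono (integrable_pow_of_memLp (h.memLp_partialSum hp (n + 1)) le_rfl)
          ((i1.fun_add (i2.const_mul _)).fun_add ((i3.const_mul _).fun_add (i4.const_mul _))) fun ω => ?_
        have := (abs_le.1 (hpow (partialSum Y n ω) (Y n ω))).2
        rw [(even_two_mul j).pow_abs,
          (show Even (2 * j + 2) from ⟨j + 1, by ring⟩).pow_abs] at this
        simp only [partialSum_succ, show 2 * (j + 1) = 2 * j + 2 by ring]
        linarith
      have e4 : ∫ ω, Y n ω ^ (2 * (j + 1)) ∂μ = κ :=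
        ((h.ident n).comp (measurable_id.pow_const _)).integral_eq
      rw [integral_add (i1.fun_add (i2.const_mul _)) ((i3.const_mul _).fun_add (i4.const_mul _)),
        integral_add (f := fun ω => partialSum Y n ω ^ (2 * (j + 1))) i1 (i2.const_mul _),
        integral_add (f := fun ω => D * (partialSum Y n ω ^ (2 * j) * Y n ω ^ 2))
          (i3.const_mul _) (i4.const_mul _),
        integral_const_mul, integral_const_mul, integral_const_mul,
        h.integral_pow_mul_pow, h.integral_pow_mul_pow, e4] at step
      simp only [pow_one, h0, mul_zero, add_zero] at step
      rw [← hv] at step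
      have hn : (0 : ℝ) ≤ n := Nat.cast_nonneg n
      have hn1 : (n : ℝ) ^ j ≤ (n + 1 : ℝ) ^ j := by gcongr; linarith
      have hn2 : (1 : ℝ) ≤ (n + 1 : ℝ) ^ j := one_le_pow₀ (by linarith)
      have b1 : (∫ ω, partialSum Y n ω ^ (2 * j) ∂μ) * v ≤ C * (n + 1 : ℝ) ^ j * v := by
        gcongr
        exact (hS n).trans (by gcongr)
      have b2 : D * ((∫ ω, partialSum Y n ω ^ (2 * j) ∂μ) * v) + D * κ ≤ A * (n + 1 : ℝ) ^ j := by
        calc _ ≤ D * (C * (n + 1 : ℝ) ^ j * v) + D * (κ * (n + 1 : ℝ) ^ j) := by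
              gcongr
              exact le_mul_of_one_le_right hκ0 hn2
          _ = _ := by rw [hA]; ring
      have b3 : A * (n : ℝ) ^ (j + 1) ≤ A * (n * (n + 1 : ℝ) ^ j) := by
        rw [pow_succ']; gcongr
      push_cast
      rw [pow_succ' ((n : ℝ) + 1) j]
      nlinarith

/-- **Chernoff bound** for sums of centered i.i.d. variables that are bounded above and have a
finite second moment. -/
lemma measureReal_partialSum_ge_le (h : IsIID Y μ) (h0 : ∫ ω, Y 0 ω ∂μ = 0)
    (hp : MemLp (Y 0) 2 μ) {b l : ℝ} (hb : ∀ᵐ ω ∂μ, Y 0 ω ≤ b) (hl : 0 ≤ l) (hlb : l * b ≤ 1)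
    (n : ℕ) (t : ℝ) :
    μ.real {ω | t ≤ partialSum Y n ω} ≤
      Real.exp (-l * t + n * (l ^ 2 * ∫ ω, Y 0 ω ^ 2 ∂μ)) := by
  have hY1 : ∀ᵐ ω ∂μ, l * Y 0 ω ≤ 1 := by
    filter_upwards [hb] with ω hω using (mul_le_mul_of_nonneg_left hω hl).trans hlb
  -- Valid for arbitrarily negative y; hence a one-sided bound on the summands suffices.
  have hexp (y : ℝ) (hy : y ≤ 1) : Real.exp y ≤ 1 + y + y ^ 2 := by
    rcases le_or_gt (-1) y with h1 | h1
    · have := (abs_le.1 (Real.abs_exp_sub_one_sub_id_le (abs_le.2 ⟨h1, hy⟩))).2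
      linarith
    · have : Real.exp y ≤ 1 := Real.exp_le_one_iff.2 (by linarith)
      nlinarith
  have i1 : Integrable (Y 0) μ := hp.integrable (by norm_num)
  have i2 : Integrable (fun ω => Y 0 ω ^ 2) μ := hp.integrable_sq
  have hint0 : Integrable (fun ω => Real.exp (l * Y 0 ω)) μ := by
    refine (integrable_const (Real.exp 1)).mono'
      ((h.measurable 0).const_mul l).exp.aestronglyMeasurable ?_
    filter_upwards [hY1] with ω hω
    rw [Real.norm_eq_abs, abs_of_pos (Real.exp_pos _)]
    exact Real.exp_le_exp.2 hω
  have hmgf : mgf (Y 0) μ l ≤ Real.exp (l ^ 2 * ∫ ω, Y 0 ω ^ 2 ∂μ) := by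
    have h1 : mgf (Y 0) μ l ≤ ∫ ω, (1 + l * Y 0 ω + l ^ 2 * Y 0 ω ^ 2) ∂μ := by
      refine integral_mono_ae hint0
        (((integrable_const 1).add (i1.const_mul l)).add (i2.const_mul _)) ?_
      filter_upwards [hY1] with ω hω
      have := hexp _ hω
      rwa [mul_pow] at this
    rw [integral_add ((integrable_const 1).fun_add (i1.const_mul l)) (i2.const_mul _),
      integral_add (integrable_const 1) (i1.const_mul l), integral_const_mul, integral_const_mul,
      h0] at h1
    simp only [integral_const, probReal_univ, smul_eq_mul, mul_one, mul_zero, add_zero] at h1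
    refine h1.trans ?_
    rw [add_comm]
    exact Real.add_one_le_exp _
  have hint : Integrable (fun ω => Real.exp (l * partialSum Y n ω)) μ := by
    have := h.indep.integrable_exp_mul_sum (t := l) (fun i => h.measurable i)
      (s := Finset.range n)
      (fun i _ => ((h.ident i).comp ((measurable_id.const_mul l).exp)).integrable_iff.2 hint0)
    simpa [partialSum] using this
  have hsum : partialSum Y n = ∑ i ∈ Finset.range n, Y i := by
    ext ω; simp [partialSum]
  refine (measure_ge_le_exp_mul_mgf t hl hint).trans ?_
  rw [Real.exp_add, Real.exp_nat_mul]
  refine mul_le_mul_of_nonneg_left ?_ (Real.exp_pos _).le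
  rcases n.eq_zero_or_pos with rfl | hn
  · simp [partialSum, mgf]
  · rw [hsum, mgf_sum_of_identDistrib h.measurable h.indep
      (fun i _ j _ => (h.ident i).trans (h.ident j).symm) (Finset.mem_range.2 hn) l,
      Finset.card_range]
    exact pow_le_pow_left₀ mgf_nonneg hmgf n

/-- Large deviations of the partial sums have superpolynomially small probability. -/
lemma exists_pow_mul_measureReal_le (h : IsIID Y μ) (h0 : ∫ ω, Y 0 ω ∂μ = 0)
    (hp : MemLp (Y 0) 2 μ) {b δ : ℝ} (hb : ∀ᵐ ω ∂μ, Y 0 ω ≤ b) (hδ : 0 < δ) (c : ℝ) (R : ℕ) :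
    ∃ C : ℝ, 0 ≤ C ∧ ∀ n : ℕ,
      (n + 1 : ℝ) ^ R * μ.real {ω | δ * n - c ≤ partialSum Y n ω} ≤ C := by
  set v := ∫ ω, Y 0 ω ^ 2 ∂μ with hv
  have hv0 : 0 ≤ v := integral_nonneg fun ω => sq_nonneg _
  -- The first entry ensures l b ≤ 1; the second makes the variance cost n l² v at most half of the
  -- gain n l δ. The probability then decays like exp(-x n) with x = l δ / 2.
  set l := min (1 / (|b| + 1)) (δ / (2 * (v + 1))) with hl
  have hl0 : 0 < l := lt_min (by positivity) (by positivity)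
  have hlb : l * b ≤ 1 := by
    calc l * b ≤ l * |b| := by gcongr; exact le_abs_self b
      _ ≤ 1 / (|b| + 1) * |b| := by gcongr; exact min_le_left _ _
      _ ≤ 1 := by rw [one_div, inv_mul_le_iff₀ (by positivity)]; linarith
  have hlv : l * v ≤ δ / 2 := by
    calc l * v ≤ δ / (2 * (v + 1)) * v := by gcongr; exact min_le_right _ _
      _ ≤ δ / 2 := by rw [div_mul_eq_mul_div, div_le_div_iff₀ (by positivity) (by positivity)]; nlinarith
  set x := l * δ / 2 with hx
  have hx0 : 0 < x := by positivity
  refine ⟨R.factorial / x ^ R * Real.exp (x + l * c), by positivity, fun n => ?_⟩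
  have h1 := h.measureReal_partialSum_ge_le h0 hp hb hl0.le hlb n (δ * n - c)
  rw [← hv] at h1
  have hn : (0 : ℝ) ≤ n := Nat.cast_nonneg n
  have h2 : -l * (δ * n - c) + n * (l ^ 2 * v) ≤ -x * n + l * c := by
    have : n * (l ^ 2 * v) ≤ n * (l * (δ / 2)) := by
      rw [sq, mul_assoc]; gcongr
    rw [hx]; nlinarith
  have h3 : (n + 1 : ℝ) ^ R ≤ R.factorial / x ^ R * Real.exp (x * (n + 1)) := by
    have := Real.pow_div_factorial_le_exp (x := x * (n + 1)) (by positivity) R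
    rw [mul_pow, div_le_iff₀ (by positivity)] at this
    rw [div_mul_eq_mul_div, le_div_iff₀ (by positivity)]
    linarith
  calc _ ≤ (R.factorial / x ^ R * Real.exp (x * (n + 1))) * Real.exp (-x * n + l * c) := by
        gcongr
        exact h1.trans (Real.exp_le_exp.2 h2)
    _ = _ := by rw [mul_assoc, ← Real.exp_add]; ring_nf

end IsIID

end ProbabilityTheory

/-! ### Moments of the smoothed average. -/

namespace ProbabilityTheory

variable {Ω : Type*} {Y : ℕ → Ω → ℝ}

/-- The smoothed average `(Y 0 + ⋯ + Y (n - 1) + c) / (n + n₀)`. -/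
def smoothedMean (Y : ℕ → Ω → ℝ) (c n₀ : ℝ) (n : ℕ) (ω : Ω) : ℝ :=
  (partialSum Y n ω + c) / (n + n₀)

variable [MeasurableSpace Ω] {μ : Measure Ω}

namespace IsIID

lemma measurable_smoothedMean (h : IsIID Y μ) (c n₀ : ℝ) (n : ℕ) :
    Measurable (smoothedMean Y c n₀ n) :=
  ((h.measurable_partialSum n).add_const c).div_const _

lemma indepFun_smoothedMean (h : IsIID Y μ) (c n₀ : ℝ) (n : ℕ) :
    IndepFun (smoothedMean Y c n₀ n) (Y n) μ :=
  (h.indepFun_partialSum n).comp (φ := fun s => (s + c) / (n + n₀)) (ψ := id)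
    ((measurable_id.add_const c).div_const _) measurable_id

variable [IsProbabilityMeasure μ]

lemma memLp_smoothedMean (h : IsIID Y μ) (c n₀ : ℝ) {p : ENNReal} (hp : MemLp (Y 0) p μ) (n : ℕ) :
    MemLp (smoothedMean Y c n₀ n) p μ := by
  have := ((h.memLp_partialSum hp n).add (memLp_const c)).const_mul ((n + n₀ : ℝ)⁻¹)
  refine this.ae_eq (ae_of_all _ fun ω => ?_)
  simp [smoothedMean, div_eq_inv_mul]

lemma exists_integral_smoothedMean_pow_le (h : IsIID Y μ) (h0 : ∫ ω, Y 0 ω ∂μ = 0) (j : ℕ)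
    (hp : MemLp (Y 0) (2 * j : ℕ) μ) (c : ℝ) {n₀ : ℝ} (hn₀ : 0 < n₀) :
    ∃ C : ℝ, 0 ≤ C ∧ ∀ n : ℕ, ∫ ω, smoothedMean Y c n₀ n ω ^ (2 * j) ∂μ ≤ C / (n + 1 : ℝ) ^ j := by
  obtain ⟨C, hC, hS⟩ := h.exists_integral_partialSum_pow_le h0 j hp
  -- Chosen so that q (n + 1) ≤ n + n₀; the bounds in n + 1 then hold from n = 0 on.
  set q := min 1 n₀ with hq
  have hq0 : 0 < q := lt_min one_pos hn₀
  have hc0 : 0 ≤ c ^ (2 * j) := (even_two_mul j).pow_nonneg c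
  refine ⟨2 ^ (2 * j - 1) * (C + c ^ (2 * j)) / q ^ (2 * j), by positivity, fun n => ?_⟩
  have hn : (0 : ℝ) ≤ n := Nat.cast_nonneg n
  have hnn : 0 < (n : ℝ) + n₀ := by linarith
  have hint := integrable_pow_of_memLp (h.memLp_partialSum hp n) le_rfl
  have h1 : ∫ ω, smoothedMean Y c n₀ n ω ^ (2 * j) ∂μ ≤
      ∫ ω, ((2 ^ (2 * j - 1) / (n + n₀) ^ (2 * j)) * (partialSum Y n ω ^ (2 * j) + c ^ (2 * j))) ∂μ := by
    refine integral_mono (integrable_pow_of_memLp (h.memLp_smoothedMean c n₀ hp n) le_rfl)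
      ((hint.fun_add (integrable_const _)).const_mul _) fun ω => ?_
    simp only [smoothedMean, div_pow]
    rw [div_mul_eq_mul_div]
    gcongr
    have := (even_two_mul j).add_pow_le (a := partialSum Y n ω) (b := c)
    exact this
  rw [integral_const_mul, integral_add hint (integrable_const _)] at h1
  simp only [integral_const, probReal_univ, smul_eq_mul, one_mul] at h1
  have hn1 : (n : ℝ) ^ j ≤ (n + 1 : ℝ) ^ j := by gcongr; linarith
  have hn2 : (1 : ℝ) ≤ (n + 1 : ℝ) ^ j := one_le_pow₀ (by linarith)
  have h2 : ∫ ω, partialSum Y n ω ^ (2 * j) ∂μ + c ^ (2 * j) ≤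
      (C + c ^ (2 * j)) * (n + 1 : ℝ) ^ j := by
    have := (hS n).trans (mul_le_mul_of_nonneg_left hn1 hC)
    nlinarith
  have h3 : q * (n + 1) ≤ n + n₀ := by
    have h4 : q ≤ 1 := min_le_left _ _
    have h5 : q ≤ n₀ := min_le_right _ _
    nlinarith
  have h6 : q ^ (2 * j) * ((n + 1 : ℝ) ^ j * (n + 1 : ℝ) ^ j) ≤ (n + n₀) ^ (2 * j) := by
    rw [← pow_add, ← two_mul, ← mul_pow]
    gcongr
  calc _ ≤ _ := h1
    _ ≤ 2 ^ (2 * j - 1) / (q ^ (2 * j) * ((n + 1 : ℝ) ^ j * (n + 1 : ℝ) ^ j)) *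
        ((C + c ^ (2 * j)) * (n + 1 : ℝ) ^ j) := by
      have : 0 ≤ ∫ ω, partialSum Y n ω ^ (2 * j) ∂μ + c ^ (2 * j) :=
        add_nonneg (integral_nonneg fun ω => (even_two_mul j).pow_nonneg _) hc0
      gcongr
    _ = _ := by field_simp

lemma integral_smoothedMean (h : IsIID Y μ) (h0 : ∫ ω, Y 0 ω ∂μ = 0) (hi : Integrable (Y 0) μ)
    (c n₀ : ℝ) (n : ℕ) : ∫ ω, smoothedMean Y c n₀ n ω ∂μ = c / (n + n₀) := by
  have hii (i : ℕ) : Integrable (Y i) μ := (h.ident i).integrable_iff.2 hi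
  have hS : Integrable (partialSum Y n) μ := integrable_finsetSum _ fun i _ => hii i
  simp only [smoothedMean]
  rw [integral_div, integral_add hS (integrable_const c)]
  simp only [partialSum]
  rw [integral_finsetSum _ fun i _ => hii i,
    Finset.sum_eq_zero fun i _ => ((h.ident i).integral_eq.trans h0)]
  simp

lemma integral_partialSum_sq (h : IsIID Y μ) (h0 : ∫ ω, Y 0 ω ∂μ = 0) (hp : MemLp (Y 0) 2 μ)
    (n : ℕ) : ∫ ω, partialSum Y n ω ^ 2 ∂μ = n * ∫ ω, Y 0 ω ^ 2 ∂μ := by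
  induction n with
  | zero => simp [partialSum_zero]
  | succ n ih =>
    have hp' : MemLp (Y 0) (2 : ℕ) μ := by exact_mod_cast hp
    have i1 := (h.memLp_partialSum hp n).integrable_sq
    have i2 := h.integrable_pow_mul_pow (i := 1) (j := 1) hp' one_le_two one_le_two n
    have i3 := (h.memLp hp n).integrable_sq
    have e : ∀ ω, partialSum Y (n + 1) ω ^ 2 = partialSum Y n ω ^ 2
        + 2 * (partialSum Y n ω ^ 1 * Y n ω ^ 1) + Y n ω ^ 2 := fun ω => by
      rw [partialSum_succ]; ring
    simp_rw [e]
    rw [integral_add (i1.fun_add (i2.const_mul _)) i3, integral_add i1 (i2.const_mul _),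
      integral_const_mul, h.integral_pow_mul_pow, ih,
      ((h.ident n).comp (measurable_id.pow_const 2)).integral_eq (f := fun ω => Y n ω ^ 2)]
    simp [h0]
    ring

lemma integral_smoothedMean_sq (h : IsIID Y μ) (h0 : ∫ ω, Y 0 ω ∂μ = 0) (hp : MemLp (Y 0) 2 μ)
    (c n₀ : ℝ) (n : ℕ) : ∫ ω, smoothedMean Y c n₀ n ω ^ 2 ∂μ =
      (n * (∫ ω, Y 0 ω ^ 2 ∂μ) + c ^ 2) / (n + n₀) ^ 2 := by
  have i1 := (h.memLp_partialSum hp n).integrable_sq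
  have i2 := (h.memLp_partialSum hp n).integrable (by norm_num)
  have e : ∀ ω, smoothedMean Y c n₀ n ω ^ 2 = (partialSum Y n ω ^ 2
      + 2 * c * partialSum Y n ω + c ^ 2) / (n + n₀) ^ 2 := fun ω => by
    rw [smoothedMean, div_pow]; ring
  have hz : ∫ ω, partialSum Y n ω ∂μ = 0 := by
    simp only [partialSum]
    rw [integral_finsetSum _ fun i _ => (h.memLp hp i).integrable (by norm_num),
      Finset.sum_eq_zero fun i _ => ((h.ident i).integral_eq.trans h0)]
  simp_rw [e]
  rw [integral_div, integral_add (i1.fun_add (i2.const_mul _)) (integrable_const _),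
    integral_add i1 (i2.const_mul _), integral_const_mul, hz, h.integral_partialSum_sq h0 hp]
  simp

/-- The second moment of the smoothed mean is `V / n + O(1 / n²)`. -/
lemma exists_abs_integral_smoothedMean_sq_sub_le (h : IsIID Y μ) (h0 : ∫ ω, Y 0 ω ∂μ = 0)
    (hp : MemLp (Y 0) 2 μ) (c : ℝ) {n₀ : ℝ} (hn₀ : 0 < n₀) : ∃ C : ℝ, 0 ≤ C ∧ ∀ n : ℕ, 1 ≤ n →
      |∫ ω, smoothedMean Y c n₀ n ω ^ 2 ∂μ - (∫ ω, Y 0 ω ^ 2 ∂μ) / n| ≤ C / (n : ℝ) ^ 2 := by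
  set v := ∫ ω, Y 0 ω ^ 2 ∂μ with hv
  have hv0 : 0 ≤ v := integral_nonneg fun ω => sq_nonneg _
  refine ⟨c ^ 2 + v * (2 * n₀ + n₀ ^ 2), by positivity, fun n hn => ?_⟩
  have hn' : (1 : ℝ) ≤ n := by exact_mod_cast hn
  rw [h.integral_smoothedMean_sq h0 hp, ← hv]
  have e : (n * v + c ^ 2) / (n + n₀) ^ 2 - v / n =
      (n * c ^ 2 - v * (2 * n * n₀ + n₀ ^ 2)) / (n * (n + n₀) ^ 2) := by
    field_simp; ring
  rw [e, abs_div, abs_of_pos (by positivity : (0:ℝ) < n * (n + n₀) ^ 2),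
    div_le_div_iff₀ (by positivity) (by positivity)]
  have h1 : |n * c ^ 2 - v * (2 * n * n₀ + n₀ ^ 2)| ≤ n * (c ^ 2 + v * (2 * n₀ + n₀ ^ 2)) := by
    have a1 : 0 ≤ n * c ^ 2 := by positivity
    have a2 : 0 ≤ v * (2 * n * n₀ + n₀ ^ 2) := by positivity
    have a3 : v * n₀ ^ 2 ≤ n * (v * n₀ ^ 2) := le_mul_of_one_le_left (by positivity) hn'
    rw [abs_le]
    constructor <;> nlinarith
  calc _ ≤ (n * (c ^ 2 + v * (2 * n₀ + n₀ ^ 2))) * (n : ℝ) ^ 2 := by gcongr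
    _ = (c ^ 2 + v * (2 * n₀ + n₀ ^ 2)) * (n * (n : ℝ) ^ 2) := by ring
    _ ≤ _ := by
      gcongr
      linarith

end IsIID

/-- A random variable with an integrable even power is in the corresponding `L^p` space. -/
lemma memLp_of_integrable_even_pow {f : Ω → ℝ} (hf : Measurable f) {k : ℕ} (hk : Even k)
    (hk0 : k ≠ 0) (hi : Integrable (fun ω => f ω ^ k) μ) : MemLp f k μ := by
  rw [← integrable_norm_rpow_iff hf.aestronglyMeasurable (by exact_mod_cast hk0) (by simp)]
  simpa [hk.pow_abs] using hi

end ProbabilityTheory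

/-! ### Envelopes for the second derivative of the Fisher information. -/

open ProbabilityTheory (IsIID partialSum smoothedMean IndepFun)

namespace ExpFamily

variable {𝒵 : Type*} [MeasurableSpace 𝒵] {M : ExpFamily 𝒵}
variable {Ω : Type*} {Y : ℕ → Ω → ℝ}

lemma mul_smoothedMean_eq (ε c n₀ : ℝ) (n : ℕ) (ω : Ω) :
    ε * smoothedMean Y c n₀ n ω = smoothedMean (fun i ω => ε * Y i ω) (ε * c) n₀ n ω := by
  simp only [smoothedMean, partialSum, ← Finset.mul_sum]
  ring

variable [MeasurableSpace Ω] {μ : Measure Ω}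

/-- `W n` dominates the second derivative of the Fisher information between `m₀` and the estimate
`m₀ + D n`, whenever the latter satisfies `p`; weighted moments of `D` decay at the usual rate. -/
structure IsEnvelope (M : ExpFamily 𝒵) (μ : Measure Ω) (m₀ C : ℝ) (D : ℕ → Ω → ℝ) (p : ℝ → Prop)
    (W : ℕ → Ω → ℝ) : Prop where
  nonneg : ∀ n ω, 0 ≤ W n ω
  aestronglyMeasurable : ∀ n, AEStronglyMeasurable (W n) μ
  bound : ∀ n, ∀ᵐ ω ∂μ, p (D n ω) →
    ∀ s ∈ Set.uIcc m₀ (m₀ + D n ω), |iteratedDeriv 2 M.fisherInfo s| ≤ W n ω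
  integrable_sq : ∀ n, Integrable (fun ω => W n ω * D n ω ^ 2) μ
  integrable_pow_four : ∀ n, Integrable (fun ω => W n ω * D n ω ^ 4) μ
  integral_sq_le : ∀ n : ℕ, ∫ ω, W n ω * D n ω ^ 2 ∂μ ≤ C / (n + 1)
  integral_pow_four_le : ∀ n : ℕ, ∫ ω, W n ω * D n ω ^ 4 ∂μ ≤ C / (n + 1) ^ 2

lemma IsEnvelope.add {m₀ C C' : ℝ} {D : ℕ → Ω → ℝ} {p p' : ℝ → Prop} {W W' : ℕ → Ω → ℝ}
    (h : IsEnvelope M μ m₀ C D p W) (h' : IsEnvelope M μ m₀ C' D p' W') :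
    IsEnvelope M μ m₀ (C + C') D (fun x => p x ∨ p' x) (fun n ω => W n ω + W' n ω) where
  nonneg n ω := add_nonneg (h.nonneg n ω) (h'.nonneg n ω)
  aestronglyMeasurable n := (h.aestronglyMeasurable n).add (h'.aestronglyMeasurable n)
  bound n := by
    filter_upwards [h.bound n, h'.bound n] with ω h1 h2 hp s hs
    rcases hp with hp | hp
    · exact (h1 hp s hs).trans (le_add_of_nonneg_right (h'.nonneg n ω))
    · exact (h2 hp s hs).trans (le_add_of_nonneg_left (h.nonneg n ω))
  integrable_sq n := by
    simp only [add_mul]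
    exact (h.integrable_sq n).add (h'.integrable_sq n)
  integrable_pow_four n := by
    simp only [add_mul]
    exact (h.integrable_pow_four n).add (h'.integrable_pow_four n)
  integral_sq_le n := by
    simp only [add_mul]
    rw [integral_add (h.integrable_sq n) (h'.integrable_sq n), add_div]
    exact add_le_add (h.integral_sq_le n) (h'.integral_sq_le n)
  integral_pow_four_le n := by
    simp only [add_mul]
    rw [integral_add (h.integrable_pow_four n) (h'.integrable_pow_four n), add_div]
    exact add_le_add (h.integral_pow_four_le n) (h'.integral_pow_four_le n)

variable [IsProbabilityMeasure μ]

/-- With k = 2(i + 2), weighting d² and d⁴ by 1 + |d|^(2i) yields even moments of d of order at most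
k. Those of order 2j decay like n^(-j), so the unweighted ones dominate. -/
lemma exists_isEnvelope_of_polynomial (hY : IsIID Y μ) (h0 : ∫ ω, Y 0 ω ∂μ = 0) {m₀ c n₀ ε : ℝ}
    (hn₀ : 0 < n₀) (hε : ε = 1 ∨ ε = -1) (hM : M.Regular) (hm₀ : m₀ ∈ M.meanSpace)
    (hJ : ∀ n, ∀ᵐ ω ∂μ, m₀ + smoothedMean Y c n₀ n ω ∈ M.meanSpace)
    {i : ℕ} (hp : MemLp (Y 0) (2 * (i + 2) : ℕ) μ) {A : ℝ} (hA : 0 ≤ A)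
    (hbd : ∀ m ∈ M.meanSpace, 0 ≤ ε * (m - m₀) →
      |iteratedDeriv 2 M.fisherInfo m| ≤ A * (1 + |m - m₀| ^ (2 * i))) :
    ∃ C, 0 ≤ C ∧ ∃ W, IsEnvelope M μ m₀ C (smoothedMean Y c n₀) (fun x => 0 ≤ ε * x) W := by
  have hpj {j : ℕ} (hj : j ≤ i + 2) : MemLp (Y 0) (2 * j : ℕ) μ :=
    hp.mono_exponent (by exact_mod_cast Nat.mul_le_mul_left 2 hj)
  obtain ⟨C1, hC1, h1⟩ := hY.exists_integral_smoothedMean_pow_le h0 1 (hpj (by omega)) c hn₀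
  obtain ⟨C2, hC2, h2⟩ := hY.exists_integral_smoothedMean_pow_le h0 2 (hpj (by omega)) c hn₀
  obtain ⟨C3, hC3, h3⟩ := hY.exists_integral_smoothedMean_pow_le h0 (i + 1) (hpj (by omega)) c hn₀
  obtain ⟨C4, hC4, h4⟩ := hY.exists_integral_smoothedMean_pow_le h0 (i + 2) (hpj (by omega)) c hn₀
  have hint (n : ℕ) {l : ℕ} (hl : l ≤ 2 * (i + 2)) :
      Integrable (fun ω => smoothedMean Y c n₀ n ω ^ l) μ :=
    ProbabilityTheory.integrable_pow_of_memLp (hY.memLp_smoothedMean c n₀ hp n) hl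
  have e2 (x : ℝ) : A * (1 + |x| ^ (2 * i)) * x ^ 2 = A * x ^ (2 * 1) + A * x ^ (2 * (i + 1)) := by
    rw [(even_two_mul i).pow_abs]; ring
  have e4 (x : ℝ) : A * (1 + |x| ^ (2 * i)) * x ^ 4 = A * x ^ (2 * 2) + A * x ^ (2 * (i + 2)) := by
    rw [(even_two_mul i).pow_abs]; ring
  refine ⟨A * (C1 + C2 + C3 + C4), by positivity,
    fun n ω => A * (1 + |smoothedMean Y c n₀ n ω| ^ (2 * i)), ?_⟩
  constructor
  · intro n ω; positivity
  · intro n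
    exact ((((hY.measurable_smoothedMean c n₀ n).abs.pow_const _).const_add 1).const_mul
      A).aestronglyMeasurable
  · intro n
    filter_upwards [hJ n] with ω hω hpos s hs
    have hsJ := uIcc_subset_meanSpace hM hm₀ hω hs
    have hle : |s - m₀| ≤ |smoothedMean Y c n₀ n ω| := by
      simpa using abs_sub_le_of_mem_uIcc hs
    have hs0 : 0 ≤ ε * (s - m₀) := by
      rw [Set.mem_uIcc] at hs
      rcases hε with rfl | rfl
      · rcases hs with hs | hs <;> linarith [hs.1, hs.2]
      · rcases hs with hs | hs <;> linarith [hs.1, hs.2]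
    refine (hbd s hsJ hs0).trans ?_
    gcongr
  · intro n
    simp only [e2]
    exact ((hint n (by omega)).const_mul A).add ((hint n (by omega)).const_mul A)
  · intro n
    simp only [e4]
    exact ((hint n (by omega)).const_mul A).add ((hint n (by omega)).const_mul A)
  · intro n
    simp only [e2]
    rw [integral_add ((hint n (by omega)).const_mul A) ((hint n (by omega)).const_mul A),
      integral_const_mul, integral_const_mul]
    have hn : (1 : ℝ) ≤ n + 1 := by simp
    have h5 : C3 / (n + 1 : ℝ) ^ (i + 1) ≤ C3 / (n + 1 : ℝ) := by
      gcongr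
      exact le_self_pow₀ hn (by omega)
    have h1n := h1 n
    rw [pow_one] at h1n
    calc _ ≤ A * (C1 / (n + 1)) + A * (C3 / (n + 1)) := by
          gcongr
          exact (h3 n).trans h5
      _ = A * (C1 + 0 + C3 + 0) / (n + 1) := by ring
      _ ≤ _ := by gcongr
  · intro n
    simp only [e4]
    rw [integral_add ((hint n (by omega)).const_mul A) ((hint n (by omega)).const_mul A),
      integral_const_mul, integral_const_mul]
    have hn : (1 : ℝ) ≤ n + 1 := by simp
    have h5 : C4 / (n + 1 : ℝ) ^ (i + 2) ≤ C4 / (n + 1 : ℝ) ^ 2 := by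
      gcongr
      omega
    calc _ ≤ A * (C2 / (n + 1) ^ 2) + A * (C4 / (n + 1) ^ 2) := by
          gcongr
          · exact h2 n
          · exact (h4 n).trans h5
      _ = A * (0 + C2 + 0 + C4) / (n + 1) ^ 2 := by ring
      _ ≤ _ := by gcongr

/-- The prior point x₀ has weight n₀/(n + n₀) in the estimator and lies strictly inside, so the gap
to g is at least of order 1/n and I'' at most of order n^r. Passing `a` is a large deviation, whose
probability beats any power of n. -/
lemma exists_isEnvelope_of_bounded (hY : IsIID Y μ) (h0 : ∫ ω, Y 0 ω ∂μ = 0) {m₀ x₀ n₀ ε : ℝ}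
    (hn₀ : 0 < n₀) (hε : ε = 1 ∨ ε = -1) (hM : M.Regular) (hm₀ : m₀ ∈ M.meanSpace)
    (hJ : ∀ n, ∀ᵐ ω ∂μ, m₀ + smoothedMean Y (n₀ * (x₀ - m₀)) n₀ n ω ∈ M.meanSpace)
    (hp : MemLp (Y 0) (2 * 2 : ℕ) μ) {g a A : ℝ} {r : ℕ} (ha : ε * m₀ < a)
    (hag : a < g) (hx₀ : ε * x₀ < g) (hA : 0 ≤ A) (hg : ∀ m ∈ M.meanSpace, ε * m < g)
    (hYg : ∀ᵐ ω ∂μ, ε * Y 0 ω ≤ g - ε * m₀)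
    (hbd : ∀ m ∈ M.meanSpace, 0 ≤ ε * (m - m₀) → ε * m ≤ a → |iteratedDeriv 2 M.fisherInfo m| ≤ A)
    (hbd' : ∀ m ∈ M.meanSpace, a < ε * m →
      |iteratedDeriv 2 M.fisherInfo m| ≤ A * (1 / (g - ε * m)) ^ r) :
    ∃ C, 0 ≤ C ∧ ∃ W, IsEnvelope M μ m₀ C (smoothedMean Y (n₀ * (x₀ - m₀)) n₀)
      (fun x => 0 ≤ ε * x) W := by
  set c := n₀ * (x₀ - m₀) with hc
  set D := smoothedMean Y c n₀ with hD
  have hDm (n : ℕ) : Measurable (D n) := hY.measurable_smoothedMean c n₀ n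
  have hεabs : |ε| = 1 := by rcases hε with rfl | rfl <;> simp
  -- the sequence `ε Y`
  have hεY : IsIID (fun i ω => ε * Y i ω) μ :=
    ⟨fun i => (hY.measurable i).const_mul ε,
      hY.indep.comp (fun _ x => ε * x) fun _ => measurable_id.const_mul ε,
      fun i => (hY.ident i).comp (measurable_id.const_mul ε)⟩
  have hεY0 : ∫ ω, ε * Y 0 ω ∂μ = 0 := by rw [integral_const_mul, h0, mul_zero]
  have hεYp : MemLp (fun ω => ε * Y 0 ω) 2 μ :=
    (hp.mono_exponent (by norm_num)).const_mul ε
  -- Of the exponent r + 2, the part r pays for the growth of `T` and the part 2 gives the rate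
  -- 1/n².
  obtain ⟨K, hK, hdev⟩ := hεY.exists_pow_mul_measureReal_le hεY0 hεYp hYg (sub_pos.2 ha)
    (ε * c) (r + 2)
  obtain ⟨C1, hC1, h1⟩ := hY.exists_integral_smoothedMean_pow_le h0 1
    (hp.mono_exponent (by norm_num)) c hn₀
  obtain ⟨C2, hC2, h2⟩ := hY.exists_integral_smoothedMean_pow_le h0 2 hp c hn₀
  have hint (n : ℕ) {l : ℕ} (hl : l ≤ 2 * 2) : Integrable (fun ω => D n ω ^ l) μ :=
    ProbabilityTheory.integrable_pow_of_memLp (hY.memLp_smoothedMean c n₀ hp n) hl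
  -- Since n + n₀ ≤ (1 + n₀)(n + 1), the guaranteed gap n₀(g - ε x₀)/(n + n₀) is at least q/(n + 1).
  set q := n₀ * (g - ε * x₀) / (1 + n₀) with hq
  have hq0 : 0 < q := by have := sub_pos.2 hx₀; positivity
  set b := g - ε * m₀ with hb
  have hb0 : 0 < b := by rw [hb]; linarith
  -- the event of a large deviation towards the bounded end
  set E : ℕ → Set Ω := fun n => {ω | a < ε * (m₀ + D n ω)} with hE
  have hEm (n : ℕ) : MeasurableSet (E n) :=
    measurableSet_lt measurable_const (((hDm n).const_add m₀).const_mul ε)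
  have hEprob (n : ℕ) : (n + 1 : ℝ) ^ (r + 2) * μ.real (E n) ≤ K := by
    refine le_trans ?_ (hdev n)
    gcongr
    · exact measure_ne_top _ _
    intro ω hω
    simp only [hE, Set.mem_ofPred_eq] at hω ⊢
    have hn : (0 : ℝ) < n + n₀ := by positivity
    have h3 : a - ε * m₀ < smoothedMean (fun i ω => ε * Y i ω) (ε * c) n₀ n ω := by
      rw [← mul_smoothedMean_eq, ← hD]; linarith
    rw [smoothedMean, lt_div_iff₀ hn] at h3
    have : 0 < (a - ε * m₀) * n₀ := mul_pos (sub_pos.2 ha) hn₀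
    linarith
  have hgap (n : ℕ) : ∀ᵐ ω ∂μ, q / (n + 1) ≤ g - ε * (m₀ + D n ω) := by
    have hall : ∀ᵐ ω ∂μ, ∀ i, ε * Y i ω ≤ b := ae_all_iff.2 fun i =>
      (hεY.ident i).symm.ae_mem_snd (t := Set.Iic b) measurableSet_Iic hYg
    filter_upwards [hall] with ω hω
    have hn : (0 : ℝ) < n + n₀ := by positivity
    have hsum : partialSum (fun i ω => ε * Y i ω) n ω ≤ n * b := by
      have := Finset.sum_le_sum fun i (_ : i ∈ Finset.range n) => hω i
      simpa [partialSum] using this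
    have h3 : g - ε * (m₀ + D n ω) =
        (n * b - partialSum (fun i ω => ε * Y i ω) n ω + n₀ * (g - ε * x₀)) / (n + n₀) := by
      rw [mul_add, hD, mul_smoothedMean_eq, smoothedMean, hb, hc]
      field_simp
      ring
    have h4 := sub_pos.2 hx₀
    rw [h3, hq, div_div]
    have h5 : n₀ * (g - ε * x₀) ≤
        n * b - partialSum (fun i ω => ε * Y i ω) n ω + n₀ * (g - ε * x₀) := by linarith
    refine div_le_div₀ (le_trans (by positivity) h5) h5 hn ?_
    have hn' : (0 : ℝ) ≤ n := Nat.cast_nonneg n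
    nlinarith
  -- On `E n` the deviation points towards g and cannot pass it, so powers of `D` are bounded there
  -- by powers of `b`.
  have hDb (n : ℕ) : ∀ᵐ ω ∂μ, ω ∈ E n → |D n ω| ≤ b := by
    filter_upwards [hJ n] with ω hω hωE
    have h3 := hg _ hω
    simp only [hE, Set.mem_ofPred_eq] at hωE
    have h4 : |D n ω| = |ε * D n ω| := by rw [abs_mul, hεabs, one_mul]
    rw [h4, abs_of_pos (by linarith)]
    rw [hb]
    linarith
  set T : ℕ → ℝ := fun n => A * ((n + 1 : ℝ) / q) ^ r with hT
  have hT0 (n : ℕ) : 0 ≤ T n := by positivity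
  have hTE (n : ℕ) : T n * μ.real (E n) ≤ A / q ^ r * K / (n + 1 : ℝ) ^ 2 := by
    rw [le_div_iff₀ (by positivity)]
    calc _ = A / q ^ r * ((n + 1 : ℝ) ^ (r + 2) * μ.real (E n)) := by
          rw [hT]; simp only [div_pow, pow_add]; ring
      _ ≤ _ := by gcongr; exact hEprob n
  -- weighted even moments
  have hweight (n l : ℕ) (hl : l ≤ 2 * 2) (hle : Even l) :
      Integrable (fun ω => (A + (E n).indicator (fun _ => T n) ω) * D n ω ^ l) μ ∧
      ∫ ω, (A + (E n).indicator (fun _ => T n) ω) * D n ω ^ l ∂μ ≤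
        A * ∫ ω, D n ω ^ l ∂μ + b ^ l * (A / q ^ r * K / (n + 1 : ℝ) ^ 2) := by
    have hbi : Integrable (fun ω => A * D n ω ^ l + (E n).indicator (fun _ => T n * b ^ l) ω) μ :=
      ((hint n hl).const_mul A).fun_add ((integrable_const _).indicator (hEm n))
    have hpt : ∀ᵐ ω ∂μ, (A + (E n).indicator (fun _ => T n) ω) * D n ω ^ l ≤
        A * D n ω ^ l + (E n).indicator (fun _ => T n * b ^ l) ω := by
      filter_upwards [hDb n] with ω hω
      by_cases hωE : ω ∈ E n
      · simp only [Set.indicator_of_mem hωE, add_mul]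
        have := pow_le_pow_left₀ (abs_nonneg _) (hω hωE) l
        rw [hle.pow_abs] at this
        exact add_le_add le_rfl (mul_le_mul_of_nonneg_left this (hT0 n))
      · simp [Set.indicator_of_notMem hωE]
    have hnn (ω : Ω) : 0 ≤ (A + (E n).indicator (fun _ => T n) ω) * D n ω ^ l :=
      mul_nonneg (add_nonneg hA (Set.indicator_nonneg (fun _ _ => hT0 n) ω)) (hle.pow_nonneg _)
    have hwi : Integrable (fun ω => (A + (E n).indicator (fun _ => T n) ω) * D n ω ^ l) μ := by
      refine hbi.mono' ?_ ?_
      · exact (((measurable_const.indicator (hEm n)).const_add A).mul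
          ((hDm n).pow_const l)).aestronglyMeasurable
      · filter_upwards [hpt] with ω hω
        rwa [Real.norm_eq_abs, abs_of_nonneg (hnn ω)]
    refine ⟨hwi, (integral_mono_ae hwi hbi hpt).trans ?_⟩
    rw [integral_add ((hint n hl).const_mul A) ((integrable_const _).indicator (hEm n)),
      integral_const_mul, integral_indicator_const _ (hEm n), smul_eq_mul]
    refine add_le_add le_rfl ?_
    calc _ = b ^ l * (T n * μ.real (E n)) := by ring
      _ ≤ _ := mul_le_mul_of_nonneg_left (hTE n) (by positivity)
  refine ⟨A * (C1 + C2) + (b ^ 2 + b ^ 4) * (A / q ^ r * K), by positivity,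
    fun n ω => A + (E n).indicator (fun _ => T n) ω, ?_⟩
  constructor
  · exact fun n ω => add_nonneg hA (Set.indicator_nonneg (fun _ _ => hT0 n) ω)
  · exact fun n => ((measurable_const.indicator (hEm n)).const_add A).aestronglyMeasurable
  · intro n
    filter_upwards [hJ n, hgap n] with ω hω hωgap hpos s hs
    have hsJ := uIcc_subset_meanSpace hM hm₀ hω hs
    have hs0 : 0 ≤ ε * (s - m₀) ∧ ε * s ≤ ε * (m₀ + D n ω) := by
      rw [Set.mem_uIcc] at hs
      rcases hε with rfl | rfl
      · rcases hs with hs | hs <;> constructor <;> linarith [hs.1, hs.2]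
      · rcases hs with hs | hs <;> constructor <;> linarith [hs.1, hs.2]
    rcases le_or_gt (ε * s) a with hsa | hsa
    · exact (hbd s hsJ hs0.1 hsa).trans
        (le_add_of_nonneg_right (Set.indicator_nonneg (fun _ _ => hT0 n) ω))
    · have hωE : ω ∈ E n := hsa.trans_le hs0.2
      rw [Set.indicator_of_mem hωE]
      refine (hbd' s hsJ hsa).trans (le_trans ?_ (le_add_of_nonneg_left hA))
      have h3 : q / (n + 1) ≤ g - ε * s := by linarith [hs0.2]
      have h4 : (n + 1 : ℝ) / q = 1 / (q / (n + 1)) := by field_simp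
      simp only [hT, h4]
      have h5 : 0 < g - ε * s := lt_of_lt_of_le (by positivity) h3
      gcongr
  · exact fun n => (hweight n 2 (by norm_num) even_two).1
  · exact fun n => (hweight n 4 (by norm_num) (by decide)).1
  · intro n
    refine (hweight n 2 (by norm_num) even_two).2.trans ?_
    have h1n := h1 n
    rw [pow_one] at h1n
    have hn : (1 : ℝ) ≤ n + 1 := by simp
    have h6 : A / q ^ r * K / (n + 1 : ℝ) ^ 2 ≤ A / q ^ r * K / (n + 1 : ℝ) := by
      gcongr
      exact le_self_pow₀ hn (by omega)
    calc _ ≤ A * (C1 / (n + 1)) + b ^ 2 * (A / q ^ r * K / (n + 1)) := by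
          gcongr
      _ = (A * (C1 + 0) + (b ^ 2 + 0) * (A / q ^ r * K)) / (n + 1) := by ring
      _ ≤ _ := by
        gcongr
        positivity
  · intro n
    refine (hweight n 4 (by norm_num) (by decide)).2.trans ?_
    calc _ ≤ A * (C2 / (n + 1) ^ 2) + b ^ 4 * (A / q ^ r * K / (n + 1) ^ 2) := by
          gcongr
          exact h2 n
      _ = (A * (0 + C2) + (0 + b ^ 4) * (A / q ^ r * K)) / (n + 1) ^ 2 := by ring
      _ ≤ _ := by
        gcongr
        positivity

end ExpFamily

/-! ### Expectations of functions of the estimator. -/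

namespace ExpFamily

variable {𝒵 : Type*} [MeasurableSpace 𝒵] {M : ExpFamily 𝒵}
variable {Ω : Type*} [MeasurableSpace Ω] {μ : Measure Ω}
variable {Y : ℕ → Ω → ℝ} {m₀ c n₀ C : ℝ} {W : ℕ → Ω → ℝ}

/-- The estimator `m₀ + smoothedMean Y c n₀` takes values in the mean-value space and the second
derivative of the Fisher information along it is dominated. -/
structure IsGoodEstimator (M : ExpFamily 𝒵) (μ : Measure Ω) (Y : ℕ → Ω → ℝ) (m₀ c n₀ C : ℝ)
    (W : ℕ → Ω → ℝ) : Prop where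
  regular : M.Regular
  mem : m₀ ∈ M.meanSpace
  iid : IsIID Y μ
  centered : ∫ ω, Y 0 ω ∂μ = 0
  memLp : MemLp (Y 0) (2 * 2 : ℕ) μ
  pos : 0 < n₀
  mem_meanSpace : ∀ n, ∀ᵐ ω ∂μ, m₀ + smoothedMean Y c n₀ n ω ∈ M.meanSpace
  envelope : IsEnvelope M μ m₀ C (smoothedMean Y c n₀) (fun _ => True) W

/-- Outside the mean-value space `natOf` returns junk values of unknown measurability; cutting them
off changes nothing almost surely. -/
lemma measurable_indicator_meanSpace (hM : M.Regular) {f : ℝ → ℝ}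
    (hf : ContinuousOn f M.meanSpace) : Measurable (M.meanSpace.indicator f) := by
  classical
  rw [← Set.piecewise_eq_indicator]
  exact hf.measurable_piecewise continuousOn_const (isOpen_meanSpace hM).measurableSet

namespace IsGoodEstimator

lemma indicator_ae_eq (h : IsGoodEstimator M μ Y m₀ c n₀ C W) (f : ℝ → ℝ) (n : ℕ) :
    (fun ω => M.meanSpace.indicator f (m₀ + smoothedMean Y c n₀ n ω))
      =ᵐ[μ] fun ω => f (m₀ + smoothedMean Y c n₀ n ω) := by
  filter_upwards [h.mem_meanSpace n] with ω hω using Set.indicator_of_mem hω f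

lemma aestronglyMeasurable_comp (h : IsGoodEstimator M μ Y m₀ c n₀ C W) {f : ℝ → ℝ}
    (hf : Measurable (M.meanSpace.indicator f)) (n : ℕ) :
    AEStronglyMeasurable (fun ω => f (m₀ + smoothedMean Y c n₀ n ω)) μ :=
  (hf.comp ((h.iid.measurable_smoothedMean c n₀ n).const_add m₀)).aestronglyMeasurable.congr
    (h.indicator_ae_eq f n)

lemma ae_taylor (h : IsGoodEstimator M μ Y m₀ c n₀ C W) (n : ℕ) : ∀ᵐ ω ∂μ,
    |M.fisherInfo (m₀ + smoothedMean Y c n₀ n ω) - M.fisherInfo m₀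
      - deriv M.fisherInfo m₀ * smoothedMean Y c n₀ n ω| ≤ W n ω * smoothedMean Y c n₀ n ω ^ 2 ∧
    |M.natOf (m₀ + smoothedMean Y c n₀ n ω) - M.natOf m₀
      + M.fisherInfo m₀ * smoothedMean Y c n₀ n ω
      + deriv M.fisherInfo m₀ / 2 * smoothedMean Y c n₀ n ω ^ 2|
        ≤ W n ω * |smoothedMean Y c n₀ n ω| ^ 3 ∧
    |M.bregman m₀ (m₀ + smoothedMean Y c n₀ n ω)
      - M.fisherInfo m₀ / 2 * smoothedMean Y c n₀ n ω ^ 2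
      - deriv M.fisherInfo m₀ / 3 * smoothedMean Y c n₀ n ω ^ 3|
        ≤ W n ω * smoothedMean Y c n₀ n ω ^ 4 := by
  filter_upwards [h.mem_meanSpace n, h.envelope.bound n] with ω hω hW
  have h1 := abs_fisherInfo_taylor_le h.regular h.mem hω (hW trivial)
  have h2 := abs_natOf_taylor_le h.regular h.mem hω (hW trivial)
  have h3 := abs_bregman_taylor_le h.regular h.mem hω (hW trivial)
  rw [add_sub_cancel_left] at h1 h2 h3
  exact ⟨h1, h2, h3⟩

lemma continuousOn_bregman (hM : M.Regular) : ContinuousOn (M.bregman m₀) M.meanSpace :=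
  fun _ hm => (hasDerivAt_bregman hM m₀ hm).continuousAt.continuousWithinAt

lemma continuousOn_natOf (hM : M.Regular) : ContinuousOn M.natOf M.meanSpace :=
  fun _ hm => (continuousAt_natOf hM hm).continuousWithinAt

lemma continuousOn_fisherInfo (hM : M.Regular) : ContinuousOn M.fisherInfo M.meanSpace :=
  fun _ hm => (hasDerivAt_fisherInfo hM hm).continuousAt.continuousWithinAt

lemma ae_abs_fisherInfo_mul_sq_le (h : IsGoodEstimator M μ Y m₀ c n₀ C W) (n : ℕ) : ∀ᵐ ω ∂μ,
    |M.fisherInfo (m₀ + smoothedMean Y c n₀ n ω) * smoothedMean Y c n₀ n ω ^ 2| ≤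
      (|M.fisherInfo m₀| + |deriv M.fisherInfo m₀|) *
        (smoothedMean Y c n₀ n ω ^ 2 + smoothedMean Y c n₀ n ω ^ 4)
      + W n ω * smoothedMean Y c n₀ n ω ^ 4 := by
  filter_upwards [h.ae_taylor n] with ω ⟨hω, _, _⟩
  set d := smoothedMean Y c n₀ n ω
  set y := deriv M.fisherInfo m₀ * d with hy
  have := abs_add_le (M.fisherInfo (m₀ + d) - M.fisherInfo m₀ - y) (M.fisherInfo m₀ + y)
  have h2 := abs_add_le (M.fisherInfo m₀) y
  rw [show M.fisherInfo (m₀ + d) - M.fisherInfo m₀ - y + (M.fisherInfo m₀ + y)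
    = M.fisherInfo (m₀ + d) by ring] at this
  rw [hy, abs_mul (deriv M.fisherInfo m₀)] at h2
  have h3 : |d| * d ^ 2 ≤ d ^ 2 + d ^ 4 := by
    rw [← sq_abs d, ← (by decide : Even 4).pow_abs d]
    nlinarith [sq_nonneg (|d| * (1 - |d|)), abs_nonneg d, sq_nonneg (|d| ^ 2), sq_nonneg |d|]
  have h4 : 0 ≤ d ^ 4 := by positivity
  have hd2 := sq_nonneg d
  rw [abs_mul, abs_of_nonneg hd2]
  calc |M.fisherInfo (m₀ + d)| * d ^ 2
      ≤ (|M.fisherInfo m₀| + |deriv M.fisherInfo m₀| * |d| + W n ω * d ^ 2) * d ^ 2 := by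
        gcongr; linarith
    _ = |M.fisherInfo m₀| * d ^ 2 + |deriv M.fisherInfo m₀| * (|d| * d ^ 2) + W n ω * d ^ 4 := by
        ring
    _ ≤ |M.fisherInfo m₀| * (d ^ 2 + d ^ 4) + |deriv M.fisherInfo m₀| * (d ^ 2 + d ^ 4)
        + W n ω * d ^ 4 := by
        gcongr; linarith
    _ = _ := by ring

variable [IsProbabilityMeasure μ]

lemma integrable_pow (h : IsGoodEstimator M μ Y m₀ c n₀ C W) (n : ℕ) {l : ℕ} (hl : l ≤ 4) :
    Integrable (fun ω => smoothedMean Y c n₀ n ω ^ l) μ :=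
  ProbabilityTheory.integrable_pow_of_memLp (h.iid.memLp_smoothedMean c n₀ h.memLp n) hl

lemma integrable_pow_outcome (h : IsGoodEstimator M μ Y m₀ c n₀ C W) (n : ℕ) {l : ℕ} (hl : l ≤ 4) :
    Integrable (fun ω => Y n ω ^ l) μ :=
  ProbabilityTheory.integrable_pow_of_memLp (h.iid.memLp h.memLp n) hl

lemma memLp_two (h : IsGoodEstimator M μ Y m₀ c n₀ C W) : MemLp (Y 0) 2 μ :=
  h.memLp.mono_exponent (by norm_num)

/-- Functions of the estimator are independent of the next outcome. -/
lemma integral_comp_mul (h : IsGoodEstimator M μ Y m₀ c n₀ C W) {f : ℝ → ℝ}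
    (hf : Measurable (M.meanSpace.indicator f)) (n l : ℕ) (hl : l ≤ 4)
    (hfi : Integrable (fun ω => f (m₀ + smoothedMean Y c n₀ n ω)) μ) :
    Integrable (fun ω => f (m₀ + smoothedMean Y c n₀ n ω) * Y n ω ^ l) μ ∧
    ∫ ω, f (m₀ + smoothedMean Y c n₀ n ω) * Y n ω ^ l ∂μ =
      (∫ ω, f (m₀ + smoothedMean Y c n₀ n ω) ∂μ) * ∫ ω, Y 0 ω ^ l ∂μ := by
  have hae := h.indicator_ae_eq f n
  have hind : IndepFun (fun ω => M.meanSpace.indicator f (m₀ + smoothedMean Y c n₀ n ω))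
      (fun ω => Y n ω ^ l) μ :=
    (h.iid.indepFun_smoothedMean c n₀ n).comp (φ := fun d => M.meanSpace.indicator f (m₀ + d))
      (hf.comp (measurable_id.const_add m₀)) (measurable_id.pow_const l)
  have hgi := hfi.congr hae.symm
  have hmul : (fun ω => M.meanSpace.indicator f (m₀ + smoothedMean Y c n₀ n ω) * Y n ω ^ l)
      =ᵐ[μ] fun ω => f (m₀ + smoothedMean Y c n₀ n ω) * Y n ω ^ l := by
    filter_upwards [hae] with ω hω
    rw [hω]
  refine ⟨(hind.integrable_mul hgi (h.integrable_pow_outcome n hl)).congr hmul, ?_⟩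
  rw [← integral_congr_ae hmul, ← integral_congr_ae hae,
    hind.integral_fun_mul_eq_mul_integral hgi.aestronglyMeasurable
      (h.integrable_pow_outcome n hl).aestronglyMeasurable]
  congr 1
  exact ((h.iid.ident n).comp (measurable_id.pow_const l)).integral_eq

/-- Bias-variance decomposition of the weighted squared prediction error. -/
lemma integral_comp_mul_sq (h : IsGoodEstimator M μ Y m₀ c n₀ C W) {f : ℝ → ℝ}
    (hf : Measurable (M.meanSpace.indicator f)) (n : ℕ)
    (hfi : Integrable (fun ω => f (m₀ + smoothedMean Y c n₀ n ω)) μ)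
    (hfi2 : Integrable (fun ω => f (m₀ + smoothedMean Y c n₀ n ω) * smoothedMean Y c n₀ n ω ^ 2) μ) :
    Integrable (fun ω => f (m₀ + smoothedMean Y c n₀ n ω) *
      (Y n ω - smoothedMean Y c n₀ n ω) ^ 2) μ ∧
    ∫ ω, f (m₀ + smoothedMean Y c n₀ n ω) * (Y n ω - smoothedMean Y c n₀ n ω) ^ 2 ∂μ =
      (∫ ω, f (m₀ + smoothedMean Y c n₀ n ω) ∂μ) * ∫ ω, Y 0 ω ^ 2 ∂μ +
      ∫ ω, f (m₀ + smoothedMean Y c n₀ n ω) * smoothedMean Y c n₀ n ω ^ 2 ∂μ := by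
  set D := smoothedMean Y c n₀ n with hD
  have hDm : Measurable D := h.iid.measurable_smoothedMean c n₀ n
  -- The cross term in the square is g of the estimator times the centered next outcome, hence has
  -- expectation zero.
  set g : ℝ → ℝ := fun m => f m * (m - m₀) with hg
  have hgm : Measurable (M.meanSpace.indicator g) := by
    have : M.meanSpace.indicator g = fun m => M.meanSpace.indicator f m * (m - m₀) := by
      ext m; by_cases hm : m ∈ M.meanSpace <;> simp [hm, hg]
    rw [this]
    exact hf.mul (measurable_id.sub_const m₀)
  have hge (ω : Ω) : g (m₀ + D ω) = f (m₀ + D ω) * D ω := by simp [hg]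
  have hgi : Integrable (fun ω => g (m₀ + D ω)) μ := by
    refine (hfi.abs.add hfi2.abs).mono' (h.aestronglyMeasurable_comp hgm n)
      (ae_of_all _ fun ω => ?_)
    rw [hge, Pi.add_apply, Real.norm_eq_abs, abs_mul, abs_mul]
    have h1 : |D ω| ≤ 1 + |D ω ^ 2| := by
      rw [abs_of_nonneg (sq_nonneg (D ω)), ← sq_abs (D ω)]
      nlinarith [sq_nonneg (|D ω| - 1)]
    nlinarith [abs_nonneg (f (m₀ + D ω))]
  obtain ⟨i2, e2⟩ := h.integral_comp_mul hf n 2 (by norm_num) hfi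
  obtain ⟨i1, e1⟩ := h.integral_comp_mul hgm n 1 (by norm_num) hgi
  have hsum : (fun ω => f (m₀ + D ω) * (Y n ω - D ω) ^ 2) = fun ω =>
      f (m₀ + D ω) * Y n ω ^ 2 + (-2) * (g (m₀ + D ω) * Y n ω ^ 1) + f (m₀ + D ω) * D ω ^ 2 := by
    ext ω; rw [hge]; ring
  rw [hsum]
  refine ⟨(i2.fun_add (i1.const_mul (-2))).fun_add hfi2, ?_⟩
  rw [integral_add (i2.fun_add (i1.const_mul (-2))) hfi2, integral_add i2 (i1.const_mul (-2)),
    integral_const_mul, e1, e2]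
  simp only [pow_one, h.centered, mul_zero, add_zero]
  rfl

lemma integrable_bregman (h : IsGoodEstimator M μ Y m₀ c n₀ C W) (n : ℕ) :
    Integrable (fun ω => M.bregman m₀ (m₀ + smoothedMean Y c n₀ n ω)) μ := by
  have hi := (((h.integrable_pow n (l := 2) (by norm_num)).const_mul (M.fisherInfo m₀ / 2)).abs.add
    ((h.integrable_pow n (l := 3) (by norm_num)).const_mul (deriv M.fisherInfo m₀ / 3)).abs).add
    (h.envelope.integrable_pow_four n)
  refine hi.mono' (h.aestronglyMeasurable_comp (measurable_indicator_meanSpace h.regular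
    (continuousOn_bregman h.regular)) n) ?_
  filter_upwards [h.ae_taylor n] with ω ⟨_, _, hω⟩
  simp only [Pi.add_apply, Real.norm_eq_abs]
  set x := M.fisherInfo m₀ / 2 * smoothedMean Y c n₀ n ω ^ 2
  set y := deriv M.fisherInfo m₀ / 3 * smoothedMean Y c n₀ n ω ^ 3
  have := abs_add_le (M.bregman m₀ (m₀ + smoothedMean Y c n₀ n ω) - x - y) (x + y)
  have h2 := abs_add_le x y
  rw [show M.bregman m₀ (m₀ + smoothedMean Y c n₀ n ω) - x - y + (x + y)
    = M.bregman m₀ (m₀ + smoothedMean Y c n₀ n ω) by ring] at this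
  linarith

lemma integrable_natOf_sub (h : IsGoodEstimator M μ Y m₀ c n₀ C W) (n : ℕ) :
    Integrable (fun ω => M.natOf (m₀ + smoothedMean Y c n₀ n ω) - M.natOf m₀) μ := by
  have hi := (((h.integrable_pow n (l := 1) (by norm_num)).const_mul (M.fisherInfo m₀)).abs.add
    ((h.integrable_pow n (l := 2) (by norm_num)).const_mul (deriv M.fisherInfo m₀ / 2)).abs).add
    ((h.envelope.integrable_sq n).add (h.envelope.integrable_pow_four n))
  refine hi.mono' ((h.aestronglyMeasurable_comp (measurable_indicator_meanSpace h.regular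
    (continuousOn_natOf h.regular)) n).sub aestronglyMeasurable_const) ?_
  filter_upwards [h.ae_taylor n] with ω ⟨_, hω, _⟩
  have hW := h.envelope.nonneg n ω
  simp only [Pi.add_apply, Real.norm_eq_abs, pow_one]
  set d := smoothedMean Y c n₀ n ω
  set x := M.fisherInfo m₀ * d
  set y := deriv M.fisherInfo m₀ / 2 * d ^ 2
  have := abs_add_le (M.natOf (m₀ + d) - M.natOf m₀ + x + y) (-x + -y)
  have h2 := abs_add_le (-x) (-y)
  rw [abs_neg, abs_neg] at h2
  rw [show M.natOf (m₀ + d) - M.natOf m₀ + x + y + (-x + -y)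
    = M.natOf (m₀ + d) - M.natOf m₀ by ring] at this
  have h3 : |d| ^ 3 ≤ d ^ 2 + d ^ 4 := by
    rw [← sq_abs d, ← (by decide : Even 4).pow_abs d]
    nlinarith [sq_nonneg (|d| * (1 - |d|)), abs_nonneg d, sq_nonneg (|d| ^ 2), sq_nonneg |d|]
  have h4 := mul_le_mul_of_nonneg_left h3 hW
  linarith

/-- The cubic term may be estimated by absolute values: its order n^(-3/2) is still summable. -/
lemma abs_integral_bregman_sub_le (h : IsGoodEstimator M μ Y m₀ c n₀ C W) (n : ℕ) :
    |∫ ω, M.bregman m₀ (m₀ + smoothedMean Y c n₀ n ω) ∂μ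
      - M.fisherInfo m₀ / 2 * ∫ ω, smoothedMean Y c n₀ n ω ^ 2 ∂μ| ≤
    |deriv M.fisherInfo m₀| / 3 * ∫ ω, |smoothedMean Y c n₀ n ω ^ 3| ∂μ
      + ∫ ω, W n ω * smoothedMean Y c n₀ n ω ^ 4 ∂μ := by
  have i2 := h.integrable_pow n (l := 2) (by norm_num)
  have i3 := h.integrable_pow n (l := 3) (by norm_num)
  have i4 := h.envelope.integrable_pow_four n
  rw [← integral_const_mul, ← integral_sub (h.integrable_bregman n) (i2.const_mul _),
    ← integral_const_mul, ← integral_add (i3.abs.const_mul _) i4]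
  refine (abs_integral_le_integral_abs).trans ?_
  refine integral_mono_ae ((h.integrable_bregman n).sub (i2.const_mul _)).abs
    ((i3.abs.const_mul _).fun_add i4) ?_
  filter_upwards [h.ae_taylor n] with ω ⟨_, _, hω⟩
  set d := smoothedMean Y c n₀ n ω
  have := abs_add_le (M.bregman m₀ (m₀ + d) - M.fisherInfo m₀ / 2 * d ^ 2
    - deriv M.fisherInfo m₀ / 3 * d ^ 3) (deriv M.fisherInfo m₀ / 3 * d ^ 3)
  rw [sub_add_cancel, abs_mul (deriv M.fisherInfo m₀ / 3), abs_div,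
    abs_of_pos (by norm_num : (0 : ℝ) < 3)] at this
  linarith

lemma integrable_fisherInfo (h : IsGoodEstimator M μ Y m₀ c n₀ C W) (n : ℕ) :
    Integrable (fun ω => M.fisherInfo (m₀ + smoothedMean Y c n₀ n ω)) μ := by
  have hi := ((integrable_const (|M.fisherInfo m₀|)).add
    ((h.integrable_pow n (l := 1) (by norm_num)).const_mul (deriv M.fisherInfo m₀)).abs).add
    (h.envelope.integrable_sq n)
  refine hi.mono' (h.aestronglyMeasurable_comp (measurable_indicator_meanSpace h.regular
    (continuousOn_fisherInfo h.regular)) n) ?_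
  filter_upwards [h.ae_taylor n] with ω ⟨hω, _, _⟩
  simp only [Pi.add_apply, Real.norm_eq_abs, pow_one]
  set d := smoothedMean Y c n₀ n ω
  set y := deriv M.fisherInfo m₀ * d
  have := abs_add_le (M.fisherInfo (m₀ + d) - M.fisherInfo m₀ - y) (M.fisherInfo m₀ + y)
  have h2 := abs_add_le (M.fisherInfo m₀) y
  rw [show M.fisherInfo (m₀ + d) - M.fisherInfo m₀ - y + (M.fisherInfo m₀ + y)
    = M.fisherInfo (m₀ + d) by ring] at this
  linarith

lemma integrable_fisherInfo_mul_sq (h : IsGoodEstimator M μ Y m₀ c n₀ C W) (n : ℕ) :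
    Integrable (fun ω => M.fisherInfo (m₀ + smoothedMean Y c n₀ n ω) *
      smoothedMean Y c n₀ n ω ^ 2) μ := by
  have hi := (((h.integrable_pow n (l := 2) (by norm_num)).fun_add
    (h.integrable_pow n (l := 4) (by norm_num))).const_mul
      (|M.fisherInfo m₀| + |deriv M.fisherInfo m₀|)).fun_add (h.envelope.integrable_pow_four n)
  exact hi.mono' ((h.aestronglyMeasurable_comp (measurable_indicator_meanSpace h.regular
    (continuousOn_fisherInfo h.regular)) n).mul
      ((h.iid.measurable_smoothedMean c n₀ n).pow_const 2).aestronglyMeasurable)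
    (h.ae_abs_fisherInfo_mul_sq_le n)

lemma abs_integral_fisherInfo_mul_sq_le (h : IsGoodEstimator M μ Y m₀ c n₀ C W) (n : ℕ) :
    |∫ ω, M.fisherInfo (m₀ + smoothedMean Y c n₀ n ω) * smoothedMean Y c n₀ n ω ^ 2 ∂μ| ≤
      (|M.fisherInfo m₀| + |deriv M.fisherInfo m₀|) *
        (∫ ω, smoothedMean Y c n₀ n ω ^ 2 ∂μ + ∫ ω, smoothedMean Y c n₀ n ω ^ 4 ∂μ)
      + ∫ ω, W n ω * smoothedMean Y c n₀ n ω ^ 4 ∂μ := by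
  have i2 := h.integrable_pow n (l := 2) (by norm_num)
  have i4 := h.integrable_pow n (l := 4) (by norm_num)
  have hw := h.envelope.integrable_pow_four n
  rw [← integral_add i2 i4, ← integral_const_mul, ← integral_add ((i2.fun_add i4).const_mul _) hw]
  exact abs_integral_le_integral_abs.trans (integral_mono_ae
    (h.integrable_fisherInfo_mul_sq n).abs (((i2.fun_add i4).const_mul _).fun_add hw)
    (h.ae_abs_fisherInfo_mul_sq_le n))

/-- Here the linear term must be integrated before taking absolute values: the bias of the estimator
is O(1/n), while E|d| would give only n^(-1/2). -/
lemma abs_integral_fisherInfo_sub_le (h : IsGoodEstimator M μ Y m₀ c n₀ C W) (n : ℕ) :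
    |∫ ω, M.fisherInfo (m₀ + smoothedMean Y c n₀ n ω) ∂μ - M.fisherInfo m₀| ≤
      |deriv M.fisherInfo m₀| * |∫ ω, smoothedMean Y c n₀ n ω ∂μ|
      + ∫ ω, W n ω * smoothedMean Y c n₀ n ω ^ 2 ∂μ := by
  have i1 : Integrable (smoothedMean Y c n₀ n) μ := by
    simpa using h.integrable_pow n (l := 1) (by norm_num)
  have iF := h.integrable_fisherInfo n
  have key : |∫ ω, (M.fisherInfo (m₀ + smoothedMean Y c n₀ n ω) - M.fisherInfo m₀
      - deriv M.fisherInfo m₀ * smoothedMean Y c n₀ n ω) ∂μ| ≤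
      ∫ ω, W n ω * smoothedMean Y c n₀ n ω ^ 2 ∂μ := by
    refine abs_integral_le_integral_abs.trans (integral_mono_ae
      ((iF.sub (integrable_const _)).sub (i1.const_mul _)).abs (h.envelope.integrable_sq n) ?_)
    filter_upwards [h.ae_taylor n] with ω ⟨hω, _, _⟩ using hω
  rw [integral_sub (f := fun ω => M.fisherInfo (m₀ + smoothedMean Y c n₀ n ω) - M.fisherInfo m₀)
      (iF.sub (integrable_const _)) (i1.const_mul _),
    integral_sub iF (integrable_const _), integral_const_mul] at key
  simp only [integral_const, probReal_univ, smul_eq_mul, one_mul] at key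
  rw [← abs_mul]
  have := abs_add_le (∫ ω, M.fisherInfo (m₀ + smoothedMean Y c n₀ n ω) ∂μ - M.fisherInfo m₀
      - deriv M.fisherInfo m₀ * ∫ ω, smoothedMean Y c n₀ n ω ∂μ)
      (deriv M.fisherInfo m₀ * ∫ ω, smoothedMean Y c n₀ n ω ∂μ)
  rw [sub_add_cancel] at this
  linarith

end IsGoodEstimator

end ExpFamily

/-! ### The expected gain from squashing and the one-step redundancy. -/

lemma sub_log_one_add_le {x : ℝ} (hx : 0 ≤ x) : x - Real.log (1 + x) ≤ x ^ 2 / 2 := by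
  have h := Real.le_log_one_add_of_nonneg hx
  have h2 : x - 2 * x / (x + 2) = x ^ 2 / (x + 2) := by field_simp; ring
  have h3 : x ^ 2 / (x + 2) ≤ x ^ 2 / 2 := by gcongr; linarith
  linarith

lemma log_one_add_le {x : ℝ} (hx : 0 ≤ x) : Real.log (1 + x) ≤ x := by
  have := Real.log_le_sub_one_of_pos (by linarith : 0 < 1 + x)
  linarith

namespace ExpFamily.IsGoodEstimator

variable {𝒵 : Type*} [MeasurableSpace 𝒵] {M : ExpFamily 𝒵}
variable {Ω : Type*} [MeasurableSpace Ω] {μ : Measure Ω}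
variable {Y : ℕ → Ω → ℝ} {m₀ c n₀ C : ℝ} {W : ℕ → Ω → ℝ}

/-- The logarithm of the squashing factor's numerator at the next outcome. -/
def logSquash (M : ExpFamily 𝒵) (Y : ℕ → Ω → ℝ) (m₀ c n₀ : ℝ) (n : ℕ) (ω : Ω) : ℝ :=
  Real.log (1 + 1 / (2 * (n : ℝ)) * (M.fisherInfo (m₀ + smoothedMean Y c n₀ n ω) *
    (Y n ω - smoothedMean Y c n₀ n ω) ^ 2))

lemma ae_error_nonneg (h : IsGoodEstimator M μ Y m₀ c n₀ C W) (n : ℕ) : ∀ᵐ ω ∂μ,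
    0 ≤ 1 / (2 * (n : ℝ)) * (M.fisherInfo (m₀ + smoothedMean Y c n₀ n ω) *
      (Y n ω - smoothedMean Y c n₀ n ω) ^ 2) := by
  filter_upwards [h.mem_meanSpace n] with ω hω
  have := (fisherInfo_pos h.regular hω).le
  positivity

/-- The Fisher information is bounded close to `m₀`, and its restriction to the complement of a
neighbourhood of `m₀` is of second order. -/
lemma exists_cutoff (h : IsGoodEstimator M μ Y m₀ c n₀ C W) :
    ∃ (B a : ℝ) (S : Set ℝ), 0 ≤ B ∧ 0 ≤ a ∧
      Measurable (M.meanSpace.indicator (S.indicator M.fisherInfo)) ∧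
      (∀ m ∉ S, |M.fisherInfo m| ≤ B) ∧
      ∀ n, ∀ᵐ ω ∂μ, 0 ≤ S.indicator M.fisherInfo (m₀ + smoothedMean Y c n₀ n ω) ∧
        S.indicator M.fisherInfo (m₀ + smoothedMean Y c n₀ n ω) ≤
          a * smoothedMean Y c n₀ n ω ^ 2 + W n ω * smoothedMean Y c n₀ n ω ^ 2 := by
  obtain ⟨δ, hδ, hball⟩ := Metric.nhds_basis_closedBall.mem_iff.1
    ((isOpen_meanSpace h.regular).mem_nhds h.mem)
  obtain ⟨B, hB⟩ := (isCompact_closedBall m₀ δ).exists_bound_of_continuousOn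
    ((continuousOn_fisherInfo h.regular).mono hball)
  have hB0 : 0 ≤ B := (norm_nonneg _).trans (hB m₀ (Metric.mem_closedBall_self hδ.le))
  have hSm : MeasurableSet {m : ℝ | δ < |m - m₀|} :=
    measurableSet_lt measurable_const (measurable_id.sub_const m₀).abs
  set I₀ := M.fisherInfo m₀ with hI₀
  set I₁ := deriv M.fisherInfo m₀ with hI₁
  refine ⟨B, |I₀| / δ ^ 2 + |I₁| / δ, {m | δ < |m - m₀|}, hB0, by positivity, ?_,
    fun m hm => ?_, fun n => ?_⟩
  · rw [Set.indicator_indicator, Set.inter_comm, ← Set.indicator_indicator]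
    exact (measurable_indicator_meanSpace h.regular (continuousOn_fisherInfo h.regular)).indicator
      hSm
  · refine hB _ ?_
    rw [Metric.mem_closedBall, Real.dist_eq]
    simpa using hm
  filter_upwards [h.ae_taylor n, h.mem_meanSpace n] with ω ⟨hω, _, _⟩ hωJ
  have hW := h.envelope.nonneg n ω
  set d := smoothedMean Y c n₀ n ω
  by_cases hd : m₀ + d ∈ {m | δ < |m - m₀|}
  · rw [Set.indicator_of_mem hd]
    refine ⟨(fisherInfo_pos h.regular hωJ).le, ?_⟩
    simp only [Set.mem_ofPred_eq, add_sub_cancel_left] at hd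
    -- Away from `m₀` this factor upgrades the constant and linear Taylor terms to multiples of d².
    have h1 : 1 ≤ |d| / δ := (one_le_div hδ).2 hd.le
    have h2 : |I₁| * |d| ≤ |I₁| / δ * d ^ 2 := by
      calc |I₁| * |d| ≤ |I₁| * |d| * (|d| / δ) := le_mul_of_one_le_right (by positivity) h1
        _ = |I₁| / δ * |d| ^ 2 := by ring
        _ = _ := by rw [sq_abs]
    have h3 : |I₀| ≤ |I₀| / δ ^ 2 * d ^ 2 := by
      calc |I₀| ≤ |I₀| * (|d| / δ) ^ 2 :=
            le_mul_of_one_le_right (abs_nonneg _) (one_le_pow₀ h1)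
        _ = |I₀| / δ ^ 2 * |d| ^ 2 := by ring
        _ = _ := by rw [sq_abs]
    have h4 := (abs_le.1 hω).2
    have h5 := le_abs_self I₀
    have h6 := le_abs_self (I₁ * d)
    rw [abs_mul] at h6
    rw [add_mul]
    linarith
  · rw [Set.indicator_of_notMem hd]
    exact ⟨le_rfl, by positivity⟩

/-- Pointwise bound for the error made by linearizing the squashing factor. -/
lemma ae_error_sub_logSquash_le (h : IsGoodEstimator M μ Y m₀ c n₀ C W) {B : ℝ} {S : Set ℝ}
    (hB : ∀ m ∉ S, |M.fisherInfo m| ≤ B)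
    (n : ℕ) (hn : 1 ≤ n) : ∀ᵐ ω ∂μ,
    1 / (2 * (n : ℝ)) * (M.fisherInfo (m₀ + smoothedMean Y c n₀ n ω) *
        (Y n ω - smoothedMean Y c n₀ n ω) ^ 2) - logSquash M Y m₀ c n₀ n ω ≤
      B ^ 2 / (n : ℝ) ^ 2 * (Y n ω ^ 4 + smoothedMean Y c n₀ n ω ^ 4) +
      1 / n * (S.indicator M.fisherInfo (m₀ + smoothedMean Y c n₀ n ω) *
        (Y n ω - smoothedMean Y c n₀ n ω) ^ 2) := by
  have hn0 : (0 : ℝ) < n := by exact_mod_cast hn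
  filter_upwards [h.ae_error_nonneg n, h.mem_meanSpace n] with ω hω hωJ
  have hF := (fisherInfo_pos h.regular hωJ).le
  rw [logSquash]
  generalize smoothedMean Y c n₀ n ω = d at *
  generalize Y n ω = y at *
  -- Far from `m₀` the logarithm is merely dropped, being nonnegative; near `m₀` the quadratic error
  -- of the logarithm applies with I bounded by B.
  by_cases hd : m₀ + d ∈ S
  · rw [Set.indicator_of_mem hd]
    have hle := Real.log_nonneg (x := 1 + 1 / (2 * (n : ℝ)) *
      (M.fisherInfo (m₀ + d) * (y - d) ^ 2)) (by linarith)
    have h1 : 1 / (2 * (n : ℝ)) * (M.fisherInfo (m₀ + d) * (y - d) ^ 2) ≤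
        1 / n * (M.fisherInfo (m₀ + d) * (y - d) ^ 2) := by
      gcongr
      linarith
    have h2 : 0 ≤ B ^ 2 / (n : ℝ) ^ 2 * (y ^ 4 + d ^ 4) := by positivity
    linarith
  · rw [Set.indicator_of_notMem hd, zero_mul, mul_zero, add_zero]
    refine (sub_log_one_add_le hω).trans ?_
    have h2 : M.fisherInfo (m₀ + d) ^ 2 ≤ B ^ 2 := by
      rw [← sq_abs (M.fisherInfo _)]
      exact pow_le_pow_left₀ (abs_nonneg _) (hB _ hd) 2
    have h3 : (y - d) ^ 4 ≤ 8 * (y ^ 4 + d ^ 4) := by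
      have := (by decide : Even 4).add_pow_le (a := y) (b := -d)
      rw [(by decide : Even 4).neg_pow] at this
      norm_num at this
      rwa [sub_eq_add_neg]
    calc _ = M.fisherInfo (m₀ + d) ^ 2 * (y - d) ^ 4 / (8 * (n : ℝ) ^ 2) := by field_simp; ring
      _ ≤ B ^ 2 * (8 * (y ^ 4 + d ^ 4)) / (8 * (n : ℝ) ^ 2) := by gcongr
      _ = _ := by field_simp

variable [IsProbabilityMeasure μ]

lemma exists_moment_bounds (h : IsGoodEstimator M μ Y m₀ c n₀ C W) : ∃ K : ℝ, 0 ≤ K ∧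
    ∀ n : ℕ, 1 ≤ n →
      |∫ ω, smoothedMean Y c n₀ n ω ∂μ| ≤ K / n ∧
      |∫ ω, smoothedMean Y c n₀ n ω ^ 2 ∂μ - (∫ ω, Y 0 ω ^ 2 ∂μ) / n| ≤ K / (n : ℝ) ^ 2 ∧
      ∫ ω, smoothedMean Y c n₀ n ω ^ 2 ∂μ ≤ K / n ∧
      ∫ ω, smoothedMean Y c n₀ n ω ^ 4 ∂μ ≤ K / (n : ℝ) ^ 2 ∧
      ∫ ω, |smoothedMean Y c n₀ n ω ^ 3| ∂μ ≤ K / (n * √n) ∧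
      ∫ ω, W n ω * smoothedMean Y c n₀ n ω ^ 2 ∂μ ≤ K / n ∧
      ∫ ω, W n ω * smoothedMean Y c n₀ n ω ^ 4 ∂μ ≤ K / (n : ℝ) ^ 2 := by
  obtain ⟨C1, hC1, h1⟩ := h.iid.exists_integral_smoothedMean_pow_le h.centered 1
    (h.memLp.mono_exponent (by norm_num)) c h.pos
  obtain ⟨C2, hC2, h2⟩ := h.iid.exists_integral_smoothedMean_pow_le h.centered 2 h.memLp c h.pos
  obtain ⟨C3, hC3, h3⟩ := h.iid.exists_abs_integral_smoothedMean_sq_sub_le h.centered h.memLp_two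
    c h.pos
  refine ⟨|c| + C1 + C2 + C3 + |C|, by positivity, fun n hn => ?_⟩
  have hn' : (1 : ℝ) ≤ n := by exact_mod_cast hn
  have hn0 : (0 : ℝ) < n := by linarith
  have hpos := h.pos
  have b1 : ∫ ω, smoothedMean Y c n₀ n ω ^ 2 ∂μ ≤ C1 / n := by
    have := h1 n
    rw [pow_one] at this
    refine this.trans ?_
    gcongr
    linarith
  have b2 : ∫ ω, smoothedMean Y c n₀ n ω ^ 4 ∂μ ≤ C2 / (n : ℝ) ^ 2 := by
    refine (h2 n).trans ?_
    gcongr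
    linarith
  have hC := abs_nonneg C
  have hc := abs_nonneg c
  refine ⟨?_, (h3 n hn).trans ?_, b1.trans ?_, b2.trans ?_, ?_,
    (h.envelope.integral_sq_le n).trans ?_, (h.envelope.integral_pow_four_le n).trans ?_⟩
  · rw [h.iid.integral_smoothedMean h.centered (h.memLp_two.integrable (by norm_num)), abs_div,
      abs_of_pos (by positivity : 0 < (n : ℝ) + n₀)]
    gcongr <;> linarith
  · gcongr; linarith
  · gcongr; linarith
  · gcongr; linarith
  · have i2 := h.integrable_pow n (l := 2) (by norm_num)
    have i3 := h.integrable_pow n (l := 3) (by norm_num)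
    have i4 := h.integrable_pow n (l := 4) (by norm_num)
    have hs : 0 < √(n : ℝ) := Real.sqrt_pos.2 hn0
    have hsq : √(n : ℝ) ^ 2 = n := Real.sq_sqrt hn0.le
    -- Weighted AM-GM between second and fourth moments; the weight √n balances the rates 1/n and
    -- 1/n².
    have hle : ∫ ω, |smoothedMean Y c n₀ n ω ^ 3| ∂μ ≤
        ∫ ω, (1 / √n * smoothedMean Y c n₀ n ω ^ 2 + √n * smoothedMean Y c n₀ n ω ^ 4) ∂μ := by
      refine integral_mono i3.abs ((i2.const_mul _).fun_add (i4.const_mul _)) fun ω => ?_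
      simp only
      set d := smoothedMean Y c n₀ n ω
      rw [abs_pow, ← sq_abs d, ← (by decide : Even 4).pow_abs d, one_div, inv_mul_eq_div,
        ← sub_le_iff_le_add, le_div_iff₀ hs]
      nlinarith [sq_nonneg (|d| * (1 - √n * |d|)), sq_nonneg (|d| * (1 + √n * |d|)),
        mul_nonneg hs.le (pow_nonneg (abs_nonneg d) 3)]
    rw [integral_add (i2.const_mul _) (i4.const_mul _), integral_const_mul,
      integral_const_mul] at hle
    refine hle.trans ?_
    calc _ ≤ 1 / √n * (C1 / n) + √n * (C2 / (n : ℝ) ^ 2) := by gcongr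
      _ = (C1 + C2) / (n * √n) := by
        rw [sq, ← div_div, mul_div_assoc', mul_div_assoc']
        field_simp
        rw [hsq]
        ring
      _ ≤ _ := div_le_div_of_nonneg_right (by linarith) (by positivity)
  · calc C / (n + 1 : ℝ) ≤ |C| / n := by
          gcongr
          · exact le_abs_self C
          · linarith
      _ ≤ _ := by gcongr; linarith
  · calc C / (n + 1 : ℝ) ^ 2 ≤ |C| / (n : ℝ) ^ 2 := by
          gcongr
          · exact le_abs_self C
          · linarith
      _ ≤ _ := by gcongr; linarith

lemma integrable_error (h : IsGoodEstimator M μ Y m₀ c n₀ C W) (n : ℕ) :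
    Integrable (fun ω => M.fisherInfo (m₀ + smoothedMean Y c n₀ n ω) *
      (Y n ω - smoothedMean Y c n₀ n ω) ^ 2) μ :=
  (h.integral_comp_mul_sq (measurable_indicator_meanSpace h.regular
    (continuousOn_fisherInfo h.regular)) n (h.integrable_fisherInfo n)
    (h.integrable_fisherInfo_mul_sq n)).1

lemma integrable_logSquash (h : IsGoodEstimator M μ Y m₀ c n₀ C W) (n : ℕ) :
    Integrable (logSquash M Y m₀ c n₀ n) μ := by
  have hi := (h.integrable_error n).const_mul (1 / (2 * (n : ℝ)))
  refine hi.mono' ((hi.aestronglyMeasurable.aemeasurable.const_add 1).log.aestronglyMeasurable) ?_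
  filter_upwards [h.ae_error_nonneg n] with ω hω
  rw [logSquash, Real.norm_eq_abs, abs_of_nonneg (Real.log_nonneg (by linarith))]
  exact log_one_add_le hω

lemma exists_abs_integral_error_sub_le (h : IsGoodEstimator M μ Y m₀ c n₀ C W) :
    ∃ L : ℝ, 0 ≤ L ∧ ∀ n : ℕ, 1 ≤ n →
      |∫ ω, M.fisherInfo (m₀ + smoothedMean Y c n₀ n ω) *
        (Y n ω - smoothedMean Y c n₀ n ω) ^ 2 ∂μ - M.fisherInfo m₀ * ∫ ω, Y 0 ω ^ 2 ∂μ| ≤ L / n := by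
  obtain ⟨K, hK, hmom⟩ := h.exists_moment_bounds
  set v := ∫ ω, Y 0 ω ^ 2 ∂μ with hv
  have hv0 : 0 ≤ v := integral_nonneg fun ω => sq_nonneg _
  refine ⟨((|M.fisherInfo m₀| + |deriv M.fisherInfo m₀|) * (K + K) + K)
    + v * (|deriv M.fisherInfo m₀| * K + K), by positivity, fun n hn => ?_⟩
  have hn' : (1 : ℝ) ≤ n := by exact_mod_cast hn
  have hn0 : (0 : ℝ) < n := by linarith
  obtain ⟨m1, -, m2, m4, -, w2, w4⟩ := hmom n hn
  have hKsq : K / (n : ℝ) ^ 2 ≤ K / n := by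
    gcongr
    exact le_self_pow₀ hn' (by omega)
  rw [(h.integral_comp_mul_sq (measurable_indicator_meanSpace h.regular
    (continuousOn_fisherInfo h.regular)) n (h.integrable_fisherInfo n)
    (h.integrable_fisherInfo_mul_sq n)).2, ← hv]
  have e1 := h.abs_integral_fisherInfo_sub_le n
  have e2 := h.abs_integral_fisherInfo_mul_sq_le n
  have m4' := m4.trans hKsq
  have w4' := w4.trans hKsq
  generalize ∫ ω, M.fisherInfo (m₀ + smoothedMean Y c n₀ n ω) ∂μ = x at *
  generalize ∫ ω, M.fisherInfo (m₀ + smoothedMean Y c n₀ n ω) * smoothedMean Y c n₀ n ω ^ 2 ∂μ = y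
    at *
  generalize M.fisherInfo m₀ = I₀ at *
  generalize deriv M.fisherInfo m₀ = I₁ at *
  have e3 : |x - I₀| ≤ (|I₁| * K + K) / n := by
    calc _ ≤ |I₁| * (K / n) + K / n := e1.trans (by gcongr)
      _ = _ := by ring
  have e4 : |y| ≤ ((|I₀| + |I₁|) * (K + K) + K) / n := by
    calc _ ≤ (|I₀| + |I₁|) * (K / n + K / n) + K / n := e2.trans (by gcongr)
      _ = _ := by ring
  calc |x * v + y - I₀ * v| = |y + v * (x - I₀)| := by ring_nf
    _ ≤ |y| + v * |x - I₀| := by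
      refine (abs_add_le _ _).trans ?_
      rw [abs_mul v, abs_of_nonneg hv0]
    _ ≤ ((|I₀| + |I₁|) * (K + K) + K) / n + v * ((|I₁| * K + K) / n) := by gcongr
    _ = _ := by ring

/-- Near `m₀` fourth moments over n² suffice. The far part f of I is at most (a + W) d²; after
splitting off the next outcome by independence, f and f d² have expectation O(1/n), and the
prefactor 1/n supplies the second power. -/
lemma exists_integral_error_sub_logSquash_le (h : IsGoodEstimator M μ Y m₀ c n₀ C W) :
    ∃ R : ℝ, 0 ≤ R ∧ ∀ n : ℕ, 1 ≤ n →
      ∫ ω, (1 / (2 * (n : ℝ)) * (M.fisherInfo (m₀ + smoothedMean Y c n₀ n ω) *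
        (Y n ω - smoothedMean Y c n₀ n ω) ^ 2) - logSquash M Y m₀ c n₀ n ω) ∂μ
          ≤ R / (n : ℝ) ^ 2 := by
  obtain ⟨K, hK, hmom⟩ := h.exists_moment_bounds
  obtain ⟨B, a, S, hB0, ha0, hfm, hB, hfae⟩ := h.exists_cutoff
  have hptw := h.ae_error_sub_logSquash_le hB
  set v := ∫ ω, Y 0 ω ^ 2 ∂μ with hv
  have hv0 : 0 ≤ v := integral_nonneg fun ω => sq_nonneg _
  set κ := ∫ ω, Y 0 ω ^ 4 ∂μ with hκ
  have hκ0 : 0 ≤ κ := integral_nonneg fun ω => by positivity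
  generalize S.indicator M.fisherInfo = f at *
  refine ⟨B ^ 2 * (κ + K) + (v * (a * K + K) + (a * K + K)), by positivity, fun n hn => ?_⟩
  have hn' : (1 : ℝ) ≤ n := by exact_mod_cast hn
  have hn0 : (0 : ℝ) < n := by linarith
  obtain ⟨-, -, m2, m4, -, w2, w4⟩ := hmom n hn
  have hKsq : K / (n : ℝ) ^ 2 ≤ K / n := by
    gcongr
    exact le_self_pow₀ hn' (by omega)
  have i2 := h.integrable_pow n (l := 2) (by norm_num)
  have i4 := h.integrable_pow n (l := 4) (by norm_num)
  have iY4 := h.integrable_pow_outcome n (l := 4) (by norm_num)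
  have w2i := h.envelope.integrable_sq n
  have w4i := h.envelope.integrable_pow_four n
  have hfi : Integrable (fun ω => f (m₀ + smoothedMean Y c n₀ n ω)) μ := by
    refine ((i2.const_mul a).fun_add w2i).mono' (h.aestronglyMeasurable_comp hfm n) ?_
    filter_upwards [hfae n] with ω hω
    rw [Real.norm_eq_abs, abs_of_nonneg hω.1]
    exact hω.2
  have hfae2 : ∀ᵐ ω ∂μ, f (m₀ + smoothedMean Y c n₀ n ω) * smoothedMean Y c n₀ n ω ^ 2 ≤
      a * smoothedMean Y c n₀ n ω ^ 4 + W n ω * smoothedMean Y c n₀ n ω ^ 4 := by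
    filter_upwards [hfae n] with ω hω
    calc _ ≤ (a * smoothedMean Y c n₀ n ω ^ 2 + W n ω * smoothedMean Y c n₀ n ω ^ 2)
          * smoothedMean Y c n₀ n ω ^ 2 := mul_le_mul_of_nonneg_right hω.2 (sq_nonneg _)
      _ = _ := by ring
  have hfi2 : Integrable (fun ω => f (m₀ + smoothedMean Y c n₀ n ω) *
      smoothedMean Y c n₀ n ω ^ 2) μ := by
    refine ((i4.const_mul a).fun_add w4i).mono' ((h.aestronglyMeasurable_comp hfm n).mul
      ((h.iid.measurable_smoothedMean c n₀ n).pow_const 2).aestronglyMeasurable) ?_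
    filter_upwards [hfae n, hfae2] with ω hω hω2
    rwa [Real.norm_eq_abs, abs_of_nonneg (mul_nonneg hω.1 (sq_nonneg _))]
  obtain ⟨j1, j2⟩ := h.integral_comp_mul_sq hfm n hfi hfi2
  have hint := ((h.integrable_error n).const_mul (1 / (2 * (n : ℝ)))).sub (h.integrable_logSquash n)
  refine (integral_mono_ae hint (((iY4.fun_add i4).const_mul _).fun_add (j1.const_mul _))
    (hptw n hn)).trans ?_
  have eY : ∫ ω, Y n ω ^ 4 ∂μ = κ :=
    ((h.iid.ident n).comp (measurable_id.pow_const 4)).integral_eq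
  rw [integral_add ((iY4.fun_add i4).const_mul _) (j1.const_mul _), integral_const_mul,
    integral_const_mul, integral_add iY4 i4, j2, ← hv, eY]
  have e1 := integral_mono_ae hfi ((i2.const_mul a).fun_add w2i)
    ((hfae n).mono fun ω hω => hω.2)
  have e2 := integral_mono_ae hfi2 ((i4.const_mul a).fun_add w4i) hfae2
  rw [integral_add (i2.const_mul a) w2i, integral_const_mul] at e1
  rw [integral_add (i4.const_mul a) w4i, integral_const_mul] at e2
  have e3 : ∫ ω, smoothedMean Y c n₀ n ω ^ 4 ∂μ ≤ K :=
    m4.trans (div_le_self hK (one_le_pow₀ hn'))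
  have m4' := m4.trans hKsq
  have w4' := w4.trans hKsq
  generalize ∫ ω, smoothedMean Y c n₀ n ω ^ 4 ∂μ = s4 at *
  generalize ∫ ω, smoothedMean Y c n₀ n ω ^ 2 ∂μ = s2 at *
  generalize ∫ ω, W n ω * smoothedMean Y c n₀ n ω ^ 4 ∂μ = t4 at *
  generalize ∫ ω, W n ω * smoothedMean Y c n₀ n ω ^ 2 ∂μ = t2 at *
  have e1' := calc _ ≤ a * s2 + t2 := e1
    _ ≤ a * (K / n) + K / n := by gcongr
    _ = (a * K + K) / n := by ring
  have e2' := calc _ ≤ a * s4 + t4 := e2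
    _ ≤ a * (K / n) + K / n := by gcongr
    _ = (a * K + K) / n := by ring
  calc _ ≤ B ^ 2 / (n : ℝ) ^ 2 * (κ + K) +
        1 / n * ((a * K + K) / n * v + (a * K + K) / n) := by gcongr
    _ = _ := by field_simp

/-- The gain from squashing is `I(m₀) V / (2 n) + O(1 / n²)`. -/
lemma exists_abs_integral_logSquash_sub_le (h : IsGoodEstimator M μ Y m₀ c n₀ C W) :
    ∃ K : ℝ, 0 ≤ K ∧ ∀ n : ℕ, 1 ≤ n →
      |∫ ω, logSquash M Y m₀ c n₀ n ω ∂μ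
        - 1 / (2 * (n : ℝ)) * (M.fisherInfo m₀ * ∫ ω, Y 0 ω ^ 2 ∂μ)| ≤ K / (n : ℝ) ^ 2 := by
  obtain ⟨L, hL0, hlin⟩ := h.exists_abs_integral_error_sub_le
  obtain ⟨R, hR0, hlog⟩ := h.exists_integral_error_sub_logSquash_le
  refine ⟨L + R, by positivity, fun n hn => ?_⟩
  have hn0 : (0 : ℝ) < n := by exact_mod_cast hn
  have hlin := hlin n hn
  have hlog := hlog n hn
  have hlog0 : 0 ≤ ∫ ω, (1 / (2 * (n : ℝ)) * (M.fisherInfo (m₀ + smoothedMean Y c n₀ n ω) *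
      (Y n ω - smoothedMean Y c n₀ n ω) ^ 2) - logSquash M Y m₀ c n₀ n ω) ∂μ := by
    refine integral_nonneg_of_ae ?_
    filter_upwards [h.ae_error_nonneg n] with ω hω
    exact sub_nonneg.2 (log_one_add_le hω)
  rw [integral_sub ((h.integrable_error n).const_mul _) (h.integrable_logSquash n),
    integral_const_mul] at hlog hlog0
  generalize ∫ ω, M.fisherInfo (m₀ + smoothedMean Y c n₀ n ω) *
      (Y n ω - smoothedMean Y c n₀ n ω) ^ 2 ∂μ = q at *
  generalize ∫ ω, logSquash M Y m₀ c n₀ n ω ∂μ = p at *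
  generalize M.fisherInfo m₀ * ∫ ω, Y 0 ω ^ 2 ∂μ = t at *
  have hq : |1 / (2 * (n : ℝ)) * q - 1 / (2 * (n : ℝ)) * t| ≤ L / (n : ℝ) ^ 2 := by
    rw [← mul_sub, abs_mul, abs_of_pos (by positivity : 0 < 1 / (2 * (n : ℝ)))]
    calc _ ≤ 1 / (2 * (n : ℝ)) * (L / n) := by gcongr
      _ = L / (n : ℝ) ^ 2 / 2 := by field_simp
      _ ≤ _ := half_le_self (by positivity)
  rw [add_div]
  rw [abs_le] at hq ⊢
  have : 0 ≤ R / (n : ℝ) ^ 2 := by positivity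
  constructor <;> linarith [hq.1, hq.2]

/-- The expected redundancy of predicting one outcome with the squashed estimator is
`1 / (2 n) + O(n ^ (-3/2))`. -/
lemma exists_abs_redundancy_sub_le (h : IsGoodEstimator M μ Y m₀ c n₀ C W) :
    ∃ K : ℝ, 0 ≤ K ∧ ∀ n : ℕ, 1 ≤ n →
      |∫ ω, M.bregman m₀ (m₀ + smoothedMean Y c n₀ n ω) ∂μ - ∫ ω, logSquash M Y m₀ c n₀ n ω ∂μ
        + Real.log (1 + 1 / (2 * (n : ℝ))) - 1 / 2 * (n : ℝ)⁻¹| ≤ K / (n * √n) := by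
  obtain ⟨K, hK, hmom⟩ := h.exists_moment_bounds
  obtain ⟨K', hK', hsq⟩ := h.exists_abs_integral_logSquash_sub_le
  set v := ∫ ω, Y 0 ω ^ 2 ∂μ with hv
  set I₀ := M.fisherInfo m₀ with hI₀
  set I₁ := deriv M.fisherInfo m₀ with hI₁
  refine ⟨|I₁| / 3 * K + K + |I₀| / 2 * K + K' + 1, by positivity, fun n hn => ?_⟩
  have hn' : (1 : ℝ) ≤ n := by exact_mod_cast hn
  have hn0 : (0 : ℝ) < n := by linarith
  obtain ⟨-, m2, -, -, m3, -, w4⟩ := hmom n hn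
  have hb := h.abs_integral_bregman_sub_le n
  have hs := hsq n hn
  have hsqrt : n * √(n : ℝ) ≤ (n : ℝ) ^ 2 := by
    rw [sq]
    gcongr
    rw [Real.sqrt_le_left hn0.le]
    nlinarith
  have hs0 : 0 < √(n : ℝ) := Real.sqrt_pos.2 hn0
  have conv {x : ℝ} (hx : 0 ≤ x) : x / (n : ℝ) ^ 2 ≤ x / (n * √n) := by gcongr
  set b := ∫ ω, M.bregman m₀ (m₀ + smoothedMean Y c n₀ n ω) ∂μ
  set p := ∫ ω, logSquash M Y m₀ c n₀ n ω ∂μ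
  set s := ∫ ω, smoothedMean Y c n₀ n ω ^ 2 ∂μ
  set u := 1 / (2 * (n : ℝ)) with hu
  have hu0 : 0 ≤ u := by positivity
  have hl1 := sub_log_one_add_le hu0
  have hl2 := log_one_add_le hu0
  have hu2 : u ^ 2 / 2 ≤ 1 / (n : ℝ) ^ 2 := by
    calc u ^ 2 / 2 = 1 / (n : ℝ) ^ 2 / 8 := by rw [hu]; field_simp; norm_num
      _ ≤ _ := div_le_self (by positivity) (by norm_num)
  have hb' : |b - I₀ / 2 * s| ≤ |I₁| / 3 * (K / (n * √n)) + K / (n * √n) := by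
    refine hb.trans ?_
    gcongr
    exact w4.trans (conv hK)
  -- The cancellation: the leading part of the expected divergence equals that of the squashing
  -- gain, both being I(m₀)V/(2n).
  have hs2 : |I₀ / 2 * s - u * (I₀ * v)| ≤ |I₀| / 2 * (K / (n * √n)) := by
    have e : I₀ / 2 * s - u * (I₀ * v) = I₀ / 2 * (s - v / n) := by rw [hu]; field_simp
    rw [e, abs_mul, abs_div, abs_of_pos (by norm_num : (0:ℝ) < 2)]
    gcongr
    exact m2.trans (conv hK)
  have hs' := hs.trans (conv hK')
  have hl3 := hu2.trans (conv zero_le_one)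
  have hun : 1 / 2 * (n : ℝ)⁻¹ = u := by rw [hu]; field_simp
  rw [hun]
  have e : (|I₁| / 3 * K + K + |I₀| / 2 * K + K' + 1) / (n * √n) =
      |I₁| / 3 * (K / (n * √n)) + K / (n * √n) + |I₀| / 2 * (K / (n * √n)) + K' / (n * √n)
        + 1 / (n * √n) := by ring
  rw [e]
  rw [abs_le] at hb' hs2 hs' ⊢
  have : 0 ≤ 1 / (n * √(n : ℝ)) := by positivity
  constructor <;> linarith [hb'.1, hb'.2, hs2.1, hs2.2, hs'.1, hs'.2]

end ExpFamily.IsGoodEstimator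

/-! ### Summation of the one-step redundancies. -/

/-- If `a i = 1 / (2 i) + O(i ^ (-3/2))`, then its partial sums are `(1 / 2) ln n + O(1)`. -/
lemma isBigO_sum_sub_log {a : ℕ → ℝ} {K : ℝ}
    (ha : ∀ n : ℕ, 1 ≤ n → |a n - 1 / 2 * (n : ℝ)⁻¹| ≤ K / (n * √n)) :
    (fun n : ℕ => ∑ i ∈ Finset.range n, a i - 1 / 2 * Real.log n) =O[atTop]
      (fun _ : ℕ => (1 : ℝ)) := by
  have hsum : Summable fun n : ℕ => |a n - 1 / 2 * (n : ℝ)⁻¹| := by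
    refine Summable.of_norm_bounded_eventually_nat
      (g := fun n : ℕ => K * (1 / (n : ℝ) ^ (3 / 2 : ℝ)))
      ((Real.summable_one_div_nat_rpow.2 (by norm_num)).mul_left K) ?_
    filter_upwards [eventually_ge_atTop 1] with n hn
    have hn0 : (0 : ℝ) < n := by exact_mod_cast hn
    have e : (n : ℝ) ^ (3 / 2 : ℝ) = n * √n := by
      rw [Real.sqrt_eq_rpow, show (3 / 2 : ℝ) = 1 + 1 / 2 by norm_num, Real.rpow_add hn0,
        Real.rpow_one]
    rw [e, Real.norm_eq_abs, abs_abs, mul_one_div]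
    exact ha n hn
  set A := ∑' n : ℕ, |a n - 1 / 2 * (n : ℝ)⁻¹| with hA
  refine IsBigO.of_bound (A + 1) ?_
  filter_upwards [eventually_ge_atTop 1] with n hn
  obtain ⟨m, rfl⟩ := Nat.exists_eq_add_of_le' hn
  -- The term i = 0 is harmless: 0⁻¹ = 0, so the sum of reciprocals below m + 1 is the harmonic
  -- number of m.
  have h1 : |∑ i ∈ Finset.range (m + 1), (a i - 1 / 2 * (i : ℝ)⁻¹)| ≤ A :=
    (Finset.abs_sum_le_sum_abs _ _).trans (hsum.sum_le_tsum _ fun i _ => abs_nonneg _)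
  have h2 : ∑ i ∈ Finset.range (m + 1), (i : ℝ)⁻¹ = (harmonic m : ℝ) := by
    rw [Finset.sum_range_succ', harmonic]
    push_cast
    simp
  have h3 := log_add_one_le_harmonic m
  have h4 := harmonic_le_one_add_log m
  have h5 : Real.log m ≤ Real.log ((m : ℝ) + 1) := by
    rcases m.eq_zero_or_pos with rfl | hm
    · simp
    · exact Real.log_le_log (by exact_mod_cast hm) (by linarith)
  rw [Finset.sum_sub_distrib, ← Finset.mul_sum, h2] at h1
  simp only [norm_one, mul_one, Real.norm_eq_abs]
  push_cast at h3 ⊢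
  rw [abs_le] at h1 ⊢
  constructor <;> linarith [h1.1, h1.2]

/-! ### Codelengths of i.i.d. outcomes. -/

namespace ExpFamily

variable {𝒵 : Type*} [MeasurableSpace 𝒵] {M : ExpFamily 𝒵} {P : Measure 𝒵}
variable [IsProbabilityMeasure P]

/-- The statistics of the outcomes, centered at `m₀`. -/
def centered (M : ExpFamily 𝒵) (m₀ : ℝ) (i : ℕ) (ω : ℕ → 𝒵) : ℝ := M.X (ω i) - m₀

lemma measurable_centered (m₀ : ℝ) (i : ℕ) : Measurable (M.centered m₀ i) :=
  (M.measurable_X.comp (measurable_pi_apply i)).sub_const m₀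

lemma mle_eq {x₀ n₀ : ℝ} (hn₀ : 0 < n₀) (m₀ : ℝ) (n : ℕ) (ω : ℕ → 𝒵) :
    M.mle x₀ n₀ n (fun j : Fin n => ω j) =
      m₀ + smoothedMean (M.centered m₀) (n₀ * (x₀ - m₀)) n₀ n ω := by
  have hn : (n : ℝ) + n₀ ≠ 0 := by positivity
  rw [mle, smoothedMean, partialSum, Fin.sum_univ_eq_sum_range (fun i => M.X (ω i)) n]
  simp only [centered, Finset.sum_sub_distrib, Finset.sum_const, Finset.card_range, nsmul_eq_mul]
  field_simp
  ring

lemma ae_outcome {p : 𝒵 → Prop} (hp : ∀ᵐ z ∂P, p z) (i : ℕ) :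
    ∀ᵐ ω ∂(Measure.infinitePi fun _ : ℕ => P), p (ω i) :=
  (measurePreserving_eval_infinitePi (fun _ : ℕ => P) i).quasiMeasurePreserving.ae hp

lemma integrable_outcome {f : 𝒵 → ℝ} (hf : Integrable f P) (i : ℕ) :
    Integrable (fun ω => f (ω i)) (Measure.infinitePi fun _ : ℕ => P) :=
  (measurePreserving_eval_infinitePi (fun _ : ℕ => P) i).integrable_comp_of_integrable hf

lemma integral_outcome {f : 𝒵 → ℝ} (hf : AEStronglyMeasurable f P) (i : ℕ) :
    ∫ ω, f (ω i) ∂(Measure.infinitePi fun _ : ℕ => P) = ∫ z, f z ∂P := by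
  have h := (measurePreserving_eval_infinitePi (fun _ : ℕ => P) i)
  conv_rhs => rw [← h.map_eq]
  rw [integral_map h.measurable.aemeasurable (by rwa [h.map_eq])]

lemma isIID_centered (m₀ : ℝ) :
    IsIID (M.centered m₀) (Measure.infinitePi fun _ : ℕ => P) where
  measurable := measurable_centered m₀
  indep := ProbabilityTheory.iIndepFun_infinitePi (X := fun _ z => M.X z - m₀)
    fun _ => M.measurable_X.sub_const m₀
  ident i := by
    refine ⟨(measurable_centered m₀ i).aemeasurable, (measurable_centered m₀ 0).aemeasurable, ?_⟩
    have key (j : ℕ) : Measure.map (M.centered m₀ j) (Measure.infinitePi fun _ : ℕ => P) =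
        P.map fun z => M.X z - m₀ := by
      have h := measurePreserving_eval_infinitePi (fun _ : ℕ => P) j
      conv_rhs => rw [← h.map_eq]
      rw [Measure.map_map (M.measurable_X.sub_const m₀) h.measurable]
      rfl
    rw [key, key]

lemma memLp_centered {p : ENNReal} (hp : MemLp M.X p P) (m₀ : ℝ) (i : ℕ) :
    MemLp (M.centered m₀ i) p (Measure.infinitePi fun _ : ℕ => P) :=
  (hp.comp_measurePreserving (measurePreserving_eval_infinitePi (fun _ : ℕ => P) i)).sub
    (memLp_const m₀)

/-- The smoothed estimator stays in the mean-value space. -/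
lemma ae_smoothedMean_mem (hM : M.Regular) {m₀ x₀ n₀ : ℝ} (hx₀ : x₀ ∈ M.meanSpace) (hn₀ : 0 < n₀)
    (hsupp : ∀ᵐ z ∂P, M.X z ∈ closure M.meanSpace) (n : ℕ) :
    ∀ᵐ ω ∂(Measure.infinitePi fun _ : ℕ => P),
      m₀ + smoothedMean (M.centered m₀) (n₀ * (x₀ - m₀)) n₀ n ω ∈ M.meanSpace := by
  induction n with
  | zero =>
    refine ae_of_all _ fun ω => ?_
    have : m₀ + smoothedMean (M.centered m₀) (n₀ * (x₀ - m₀)) n₀ 0 ω = x₀ := by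
      rw [smoothedMean, ProbabilityTheory.partialSum_zero]
      field_simp
      simp
      ring
    rwa [this]
  | succ n ih =>
    filter_upwards [ih, ae_outcome hsupp n] with ω h1 h2
    have hconv : Convex ℝ M.meanSpace := (ordConnected_meanSpace hM).convex
    have hn : (0 : ℝ) < n + n₀ := by positivity
    rw [← (isOpen_meanSpace hM).interior_eq] at h1
    -- The new estimate is a convex combination of the old one, in the interior, and of X at the new
    -- outcome, in the closure; the old one has positive weight.
    have := hconv.combo_interior_closure_mem_interior h1 h2
      (a := (n + n₀) / (n + 1 + n₀)) (b := 1 / (n + 1 + n₀)) (by positivity) (by positivity)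
      (by field_simp; ring)
    rw [(isOpen_meanSpace hM).interior_eq] at this
    convert this using 1
    simp only [smoothedMean, ProbabilityTheory.partialSum_succ, centered, smul_eq_mul]
    push_cast
    field_simp
    ring

/-- The two ends are treated separately and their envelopes added. An unbounded end supplies the
fourth moment through k ≥ 4; if both ends are bounded, so is X. -/
lemma exists_isGoodEstimator (hM : M.Regular) {mstar x₀ n₀ : ℝ} (hint : Integrable M.X P)
    (hmean : ∫ z, M.X z ∂P = mstar) (hmstar : mstar ∈ M.meanSpace)
    (hsupp : ∀ᵐ z ∂P, M.X z ∈ closure M.meanSpace) (hcond : M.GrowthCondition P mstar)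
    (hx₀ : x₀ ∈ M.meanSpace) (hn₀ : 0 < n₀) :
    ∃ C W, IsGoodEstimator M (Measure.infinitePi fun _ : ℕ => P) (M.centered mstar) mstar
      (n₀ * (x₀ - mstar)) n₀ C W := by
  have t1 := tailBound_of_tailCondition (x₀ := x₀) hM (Or.inl rfl) hmstar hx₀ hsupp hcond.1
  have t2 := tailBound_of_tailCondition (x₀ := x₀) hM (Or.inr rfl) hmstar hx₀ hsupp hcond.2
  have hiid := isIID_centered (P := P) (M := M) mstar
  have h0 : ∫ ω, M.centered mstar 0 ω ∂(Measure.infinitePi fun _ : ℕ => P) = 0 := by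
    have := integral_outcome (P := P) (f := fun z => M.X z - mstar)
      (hint.sub (integrable_const _)).aestronglyMeasurable 0
    simp only [centered]
    rw [this, integral_sub hint (integrable_const _), hmean]
    simp
  have hJ := ae_smoothedMean_mem (m₀ := mstar) hM hx₀ hn₀ hsupp
  have hmom {k : ℕ} (hk : 4 ≤ k) (hke : Even k) (hi : Integrable (fun z => M.X z ^ k) P) :
      MemLp M.X k P :=
    ProbabilityTheory.memLp_of_integrable_even_pow M.measurable_X hke (by omega) hi
  -- a fourth moment exists
  have hX4 : MemLp M.X (2 * 2 : ℕ) P := by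
    have hle {k : ℕ} (hk : 4 ≤ k) : ((2 * 2 : ℕ) : ENNReal) ≤ (k : ENNReal) := by exact_mod_cast hk
    rcases t1 with ⟨k, hk, hke, hi, -⟩ | ⟨g, _, _, _, -, -, -, -, -, hg, -, -⟩
    · exact (hmom hk hke hi).mono_exponent (hle hk)
    rcases t2 with ⟨k, hk, hke, hi, -⟩ | ⟨g', _, _, _, -, -, -, -, -, hg', -, -⟩
    · exact (hmom hk hke hi).mono_exponent (hle hk)
    refine MemLp.of_bound M.measurable_X.aestronglyMeasurable (max g g') ?_
    filter_upwards [hg, hg'] with z h1 h2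
    rw [Real.norm_eq_abs, abs_le']
    exact ⟨le_max_of_le_left (by linarith), le_max_of_le_right (by linarith)⟩
  have hY4 := memLp_centered hX4 mstar 0
  have henv (ε : ℝ) (hε : ε = 1 ∨ ε = -1) (t : M.TailBound P mstar x₀ ε) :
      ∃ C, 0 ≤ C ∧ ∃ W, IsEnvelope M (Measure.infinitePi fun _ : ℕ => P) mstar C
        (smoothedMean (M.centered mstar) (n₀ * (x₀ - mstar)) n₀) (fun x => 0 ≤ ε * x) W := by
    rcases t with ⟨k, hk, hke, hi, A, hA, hbd⟩ | ⟨g, a, A, r, ha, hag, hxg, hA, hg, hXg, hbd, hbd'⟩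
    · obtain ⟨i, rfl⟩ : ∃ i, k = 2 * (i + 2) := by
        obtain ⟨j, rfl⟩ := hke
        exact ⟨j - 2, by omega⟩
      refine exists_isEnvelope_of_polynomial hiid h0 hn₀ hε hM hmstar hJ
        (memLp_centered (hmom hk hke hi) mstar 0) hA ?_
      rwa [show 2 * (i + 2) - 4 = 2 * i by omega] at hbd
    · refine exists_isEnvelope_of_bounded hiid h0 hn₀ hε hM hmstar hJ hY4 ha hag hxg hA hg ?_
        hbd hbd'
      filter_upwards [ae_outcome hXg 0] with ω hω
      rw [centered, mul_sub]
      linarith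
  obtain ⟨C1, _, W1, e1⟩ := henv 1 (Or.inl rfl) t1
  obtain ⟨C2, _, W2, e2⟩ := henv (-1) (Or.inr rfl) t2
  have e := e1.add e2
  -- Every deviation points to one of the two sides, so the side condition of the summed envelope
  -- always holds.
  refine ⟨C1 + C2, _, hM, hmstar, hiid, h0, hY4, hn₀, hJ, { e with bound := fun n => ?_ }⟩
  filter_upwards [e.bound n] with ω hω _
  refine hω ?_
  rcases le_total 0 (smoothedMean (M.centered mstar) (n₀ * (x₀ - mstar)) n₀ n ω) with hd | hd
  · left; linarith
  · right; linarith

lemma carrier_pos_of_density_pos {m : ℝ} {z : 𝒵} (h : 0 < M.density m z) : 0 < M.h z := by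
  refine (M.h_nonneg z).lt_of_ne fun h0 => ?_
  rw [density_eq, ← h0, mul_zero, mul_zero] at h
  exact lt_irrefl _ h

/-- The log-loss of the squashed density, relative to the density with mean `m₀`. -/
lemma neg_log_squashed (hM : M.Regular) {m₀ m : ℝ} (hm₀ : m₀ ∈ M.meanSpace)
    (hm : m ∈ M.meanSpace) {z : 𝒵} (hz : 0 < M.h z) (n : ℕ) :
    -Real.log (M.squashed n m z) = -Real.log (M.density m₀ z)
      + (M.natOf m - M.natOf m₀) * (M.X z - m₀) + M.bregman m₀ m
      - Real.log (1 + 1 / (2 * (n : ℝ)) * (M.fisherInfo m * (M.X z - m) ^ 2))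
      + Real.log (1 + 1 / (2 * (n : ℝ))) := by
  rw [← log_density_eq_bregman hM hm₀ hm hz, squashed]
  have hd := density_pos hM hm hz
  have hF := (fisherInfo_pos hM hm).le
  split_ifs with hn
  -- At n = 0 the convention 1/(2·0) = 0 makes both logarithms vanish, in agreement with the absence
  -- of squashing.
  · simp [hn]
  · have h1 : 0 < 1 + 1 / (2 * (n : ℝ)) * M.fisherInfo m * (M.X z - m) ^ 2 := by positivity
    have h2 : 0 < 1 + 1 / (2 * (n : ℝ)) := by positivity
    rw [Real.log_mul hd.ne' (div_pos h1 h2).ne', Real.log_div h1.ne' h2.ne', mul_assoc]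
    ring

/-- Expected log-loss of the squashed estimator at one outcome. -/
lemma IsGoodEstimator.integral_neg_log_squashed {mstar x₀ n₀ C : ℝ} {W : ℕ → (ℕ → 𝒵) → ℝ}
    (hest : IsGoodEstimator M (Measure.infinitePi fun _ : ℕ => P) (M.centered mstar) mstar
      (n₀ * (x₀ - mstar)) n₀ C W)
    (hpos : ∀ᵐ z ∂P, 0 < M.density mstar z)
    (hfin : Integrable (fun z => -Real.log (M.density mstar z)) P) (n : ℕ) :
    Integrable (fun ω : ℕ → 𝒵 =>
      -Real.log (M.squashedML x₀ n₀ n (fun j : Fin n => ω j) (ω n)))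
      (Measure.infinitePi fun _ : ℕ => P) ∧
    ∫ ω : ℕ → 𝒵, -Real.log (M.squashedML x₀ n₀ n (fun j : Fin n => ω j) (ω n))
      ∂(Measure.infinitePi fun _ : ℕ => P) =
      ∫ z, -Real.log (M.density mstar z) ∂P +
      (∫ ω, M.bregman mstar (mstar +
          smoothedMean (M.centered mstar) (n₀ * (x₀ - mstar)) n₀ n ω)
          ∂(Measure.infinitePi fun _ : ℕ => P)
        - ∫ ω, logSquash M (M.centered mstar) mstar (n₀ * (x₀ - mstar)) n₀ n ω
          ∂(Measure.infinitePi fun _ : ℕ => P)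
        + Real.log (1 + 1 / (2 * (n : ℝ)))) := by
  set ℙ := Measure.infinitePi fun _ : ℕ => P with hP
  set Y := M.centered mstar with hY
  set c := n₀ * (x₀ - mstar) with hc
  have hae : (fun ω : ℕ → 𝒵 => -Real.log (M.squashedML x₀ n₀ n (fun j : Fin n => ω j) (ω n)))
      =ᵐ[ℙ] fun ω => -Real.log (M.density mstar (ω n))
        + (M.natOf (mstar + smoothedMean Y c n₀ n ω) - M.natOf mstar) * Y n ω ^ 1
        + M.bregman mstar (mstar + smoothedMean Y c n₀ n ω)
        - logSquash M Y mstar c n₀ n ω + Real.log (1 + 1 / (2 * (n : ℝ))) := by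
    filter_upwards [hest.mem_meanSpace n, ae_outcome hpos n] with ω hω hωpos
    rw [squashedML, mle_eq hest.pos mstar,
      neg_log_squashed hest.regular hest.mem hω (carrier_pos_of_density_pos hωpos), logSquash,
      pow_one]
    simp only [hY, ExpFamily.centered, sub_sub]
  have i1 : Integrable (fun ω : ℕ → 𝒵 => -Real.log (M.density mstar (ω n))) ℙ :=
    integrable_outcome hfin n
  -- The linear term of the log-loss: a function of the past times the centered next outcome, of
  -- expectation zero.
  obtain ⟨i2, e2⟩ := hest.integral_comp_mul (f := fun m => M.natOf m - M.natOf mstar)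
    (measurable_indicator_meanSpace hest.regular
      ((IsGoodEstimator.continuousOn_natOf hest.regular).sub continuousOn_const)) n 1 (by norm_num)
    (hest.integrable_natOf_sub n)
  have i3 := hest.integrable_bregman n
  have i4 := hest.integrable_logSquash n
  have i123 := (i1.fun_add i2).fun_add i3
  have i1234 : Integrable (fun ω => -Real.log (M.density mstar (ω n))
        + (M.natOf (mstar + smoothedMean Y c n₀ n ω) - M.natOf mstar) * Y n ω ^ 1
        + M.bregman mstar (mstar + smoothedMean Y c n₀ n ω)
        - logSquash M Y mstar c n₀ n ω) ℙ := i123.sub i4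
  refine ⟨(i1234.add (integrable_const _)).congr hae.symm, ?_⟩
  rw [integral_congr_ae hae, integral_add i1234 (integrable_const _), integral_sub i123 i4,
    integral_add (i1.fun_add i2) i3, integral_add i1 i2, e2,
    integral_outcome hfin.aestronglyMeasurable n]
  simp only [pow_one, hest.centered, mul_zero, add_zero, integral_const, probReal_univ, smul_eq_mul,
    one_mul]
  ring

/-- Expected codelength of the data under a fixed element of the model. -/
lemma integral_modelCodeLength (hM : M.Regular) {mstar : ℝ} (hint : Integrable M.X P)
    (hmean : ∫ z, M.X z ∂P = mstar) (hmstar : mstar ∈ M.meanSpace)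
    (hpos : ∀ᵐ z ∂P, 0 < M.density mstar z)
    (hfin : Integrable (fun z => -Real.log (M.density mstar z)) P) (n : ℕ) {m : ℝ}
    (hm : m ∈ M.meanSpace) :
    Integrable (M.modelCodeLength m n) (Measure.infinitePi fun _ : ℕ => P) ∧
    ∫ ω, M.modelCodeLength m n ω ∂(Measure.infinitePi fun _ : ℕ => P) =
      n * (∫ z, -Real.log (M.density mstar z) ∂P + M.bregman mstar m) := by
  have hzae : (fun z => -Real.log (M.density m z)) =ᵐ[P] fun z => -Real.log (M.density mstar z)
      + (M.natOf m - M.natOf mstar) * (M.X z - mstar) + M.bregman mstar m := by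
    filter_upwards [hpos] with z hz
    exact log_density_eq_bregman hM hmstar hm (carrier_pos_of_density_pos hz)
  have iX : Integrable (fun z => (M.natOf m - M.natOf mstar) * (M.X z - mstar)) P :=
    (hint.sub (integrable_const _)).const_mul _
  have i0 : Integrable (fun z => -Real.log (M.density m z)) P :=
    ((hfin.fun_add iX).fun_add (integrable_const _)).congr hzae.symm
  have e0 : ∫ z, -Real.log (M.density m z) ∂P =
      ∫ z, -Real.log (M.density mstar z) ∂P + M.bregman mstar m := by
    rw [integral_congr_ae hzae, integral_add (hfin.fun_add iX) (integrable_const _),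
      integral_add hfin iX, integral_const_mul, integral_sub hint (integrable_const _), hmean]
    simp
  have hae : M.modelCodeLength m n =ᵐ[Measure.infinitePi fun _ : ℕ => P]
      fun ω => ∑ i ∈ Finset.range n, -Real.log (M.density m (ω i)) := by
    filter_upwards [ae_all_iff.2 fun i => ae_outcome hpos i] with ω hω
    rw [modelCodeLength, Real.log_prod fun i _ =>
      (density_pos hM hm (carrier_pos_of_density_pos (hω i))).ne', Finset.sum_neg_distrib]
  refine ⟨(integrable_finsetSum _ fun i _ => integrable_outcome i0 i).congr hae.symm, ?_⟩
  rw [integral_congr_ae hae, integral_finsetSum _ fun i _ => integrable_outcome i0 i]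
  simp only [integral_outcome i0.aestronglyMeasurable, e0, Finset.sum_const, Finset.card_range,
    nsmul_eq_mul]

end ExpFamily

end

/-! ### The relative redundancy. -/

theorem theorem2 {𝒵 : Type*} [MeasurableSpace 𝒵] (M : ExpFamily 𝒵) (hM : M.Regular)
    (P : Measure 𝒵) [IsProbabilityMeasure P]
    (mstar : ℝ) (hint : Integrable M.X P) (hmean : ∫ z, M.X z ∂P = mstar)
    (hmstar : mstar ∈ M.meanSpace)
    (hsupp : ∀ᵐ z ∂P, M.X z ∈ closure M.meanSpace)
    (hpos : ∀ᵐ z ∂P, 0 < M.density mstar z)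
    (hfin : Integrable (fun z => -Real.log (M.density mstar z)) P)
    (hcond : M.GrowthCondition P mstar)
    (x₀ n₀ : ℝ) (hx₀ : x₀ ∈ M.meanSpace) (hn₀ : 0 < n₀) :
    (∀ n : ℕ, Integrable (ExpFamily.codeLength (M.squashedML x₀ n₀) n)
      (Measure.infinitePi (fun _ : ℕ => P))) ∧
    (∀ n : ℕ, ∀ m ∈ M.meanSpace, Integrable (M.modelCodeLength m n)
      (Measure.infinitePi (fun _ : ℕ => P))) ∧
    (∀ n : ℕ, BddBelow (Set.range fun m : M.meanSpace =>
      ∫ ω, M.modelCodeLength m n ω ∂(Measure.infinitePi (fun _ : ℕ => P)))) ∧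
    (fun n : ℕ => M.relRedundancy P (M.squashedML x₀ n₀) n - 1 / 2 * Real.log n)
      =O[atTop] (fun _ : ℕ => (1 : ℝ)) := by
  obtain ⟨C, W, hest⟩ := ExpFamily.exists_isGoodEstimator hM hint hmean hmstar hsupp hcond hx₀ hn₀
  have hstep := hest.integral_neg_log_squashed hpos hfin
  have hmodel (n : ℕ) {m : ℝ} (hm : m ∈ M.meanSpace) :=
    ExpFamily.integral_modelCodeLength hM hint hmean hmstar hpos hfin n hm
  set H := ∫ z, -Real.log (M.density mstar z) ∂P with hH
  have hlower (n : ℕ) (m : M.meanSpace) :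
      n * H ≤ ∫ ω, M.modelCodeLength m n ω ∂(Measure.infinitePi (fun _ : ℕ => P)) := by
    rw [(hmodel n m.2).2]
    have := ExpFamily.bregman_nonneg hM hmstar m.2
    gcongr
    linarith
  have hbdd (n : ℕ) : BddBelow (Set.range fun m : M.meanSpace =>
      ∫ ω, M.modelCodeLength m n ω ∂(Measure.infinitePi (fun _ : ℕ => P))) :=
    ⟨n * H, Set.forall_mem_range.2 (hlower n)⟩
  -- The best element in expectation is the one whose mean is that of P, where the divergence term
  -- vanishes.
  have hinf (n : ℕ) : ⨅ m : M.meanSpace, ∫ ω, M.modelCodeLength m n ω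
      ∂(Measure.infinitePi (fun _ : ℕ => P)) = n * H := by
    have : Nonempty M.meanSpace := ⟨⟨mstar, hmstar⟩⟩
    refine le_antisymm ?_ (le_ciInf (hlower n))
    refine (ciInf_le (hbdd n) ⟨mstar, hmstar⟩).trans_eq ?_
    rw [(hmodel n hmstar).2, ExpFamily.bregman_self, add_zero]
  refine ⟨fun n => integrable_finsetSum _ fun i _ => (hstep i).1,
    fun n m hm => (hmodel n hm).1, hbdd, ?_⟩
  obtain ⟨K, -, hK⟩ := hest.exists_abs_redundancy_sub_le
  -- Both expected codelengths contain n H, which cancels; the redundancy is exactly the sum of the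
  -- one-step redundancies.
  refine (isBigO_sum_sub_log hK).congr_left fun n => ?_
  symm
  rw [ExpFamily.relRedundancy, hinf]
  simp only [ExpFamily.codeLength]
  rw [integral_finsetSum _ fun i _ => (hstep i).1, Finset.sum_congr rfl fun i _ => (hstep i).2,
    Finset.sum_add_distrib, Finset.sum_const, Finset.card_range, nsmul_eq_mul, add_sub_cancel_left]
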